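/- Let $k$ be a natural number and let $\psi(w_0,\ldots,w_{k-1})$ be a $\Sigma^1_2$-formula in the language of set theory with free second-order variables $w_0,\ldots,w_{k-1}$, i.e. a block of existential second-order quantifiers, followed by a block of universal second-order quantifiers, followed by a formula without second-order quantifiers. Then there is a $\Sigma_1$-formula $\varphi(v_0,\ldots,v_{k+1})$ in the language of set theory (existential quantifiers followed by a formula with only bounded quantifiers) such that $\mathrm{ZFC}$ proves the following statement (equivalently, the statement holds in every model of $\mathrm{ZFC}$): for every strictly increasing sequence $\vec\lambda=\langle\lambda_n\mid n<\omega\rangle$ of strong limit cardinals with supremum $\lambda$ and all $A_0,\ldots,A_{k-1}\in V_{\lambda+1}$, $$\varphi(A_0,\ldots,A_{k-1},V_\lambda,\vec\lambda)\iff\langle V_\lambda,\in\rangle\models\psi(A_0,\ldots,A_{k-1}).$$ Here $\langle V_\lambda,\in\rangle\models\psi(A_0,\ldots,A_{k-1})$ refers to full second-order semantics: the second-order variables range over all subsets of $V_\lambda$. -/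

import Mathlib

open FirstOrder

namespace SetThy

/-! ## The language of set theory -/

/-- The only non-logical symbol: the binary relation symbol of membership. -/
inductive MemRel : ℕ → Type
  | mem : MemRel 2

/-- The first-order language of set theory. -/
def setLang : FirstOrder.Language.{0, 0} := ⟨fun _ => Empty, MemRel⟩

/-- The membership symbol. -/
def memSym : setLang.Relations 2 := MemRel.mem

/-- First-order formulas of set theory whose free variables are `v₀, …, vₙ₋₁`. -/
abbrev Fml (n : ℕ) : Type := setLang.BoundedFormula Empty n

/-- The variable `i`, seen as a variable below one more quantifier. -/
abbrev _root_.Fin.up {n : ℕ} (i : Fin n) : Fin (n + 1) := i.castSucc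

/-- The variable `vᵢ` as a term. -/
abbrev vr {n : ℕ} (i : Fin n) : setLang.Term (Empty ⊕ Fin n) := FirstOrder.Language.Term.var (Sum.inr i)

/-- `vᵢ ∈ vⱼ` -/
def mem {n : ℕ} (i j : Fin n) : Fml n :=
  FirstOrder.Language.Relations.boundedFormula₂ memSym (vr i) (vr j)

/-- `vᵢ = vⱼ` -/
def eq {n : ℕ} (i j : Fin n) : Fml n := FirstOrder.Language.Term.bdEqual (vr i) (vr j)

/-- `∀ x, f x`, where `x` is a new variable. -/
def all {n : ℕ} (f : Fin (n + 1) → Fml (n + 1)) : Fml n := (f (Fin.last n)).all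

/-- `∃ x, f x`, where `x` is a new variable. -/
def ex {n : ℕ} (f : Fin (n + 1) → Fml (n + 1)) : Fml n := (f (Fin.last n)).ex

/-- `∀ x ∈ vᵢ, f x` -/
def ball {n : ℕ} (i : Fin n) (f : Fin (n + 1) → Fml (n + 1)) : Fml n :=
  all fun x => mem x i.up ⟹ f x

/-- `∃ x ∈ vᵢ, f x` -/
def bex {n : ℕ} (i : Fin n) (f : Fin (n + 1) → Fml (n + 1)) : Fml n :=
  ex fun x => mem x i.up ⊓ f x

/-! ## The Lévy hierarchy -/

/-- `Δ₀`-formulas: all quantifiers are bounded. -/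
inductive IsDelta0 : {n : ℕ} → Fml n → Prop
  | falsum {n : ℕ} : IsDelta0 (⊥ : Fml n)
  | mem {n : ℕ} (i j : Fin n) : IsDelta0 (mem i j)
  | eq {n : ℕ} (i j : Fin n) : IsDelta0 (eq i j)
  | imp {n : ℕ} {φ χ : Fml n} : IsDelta0 φ → IsDelta0 χ → IsDelta0 (φ ⟹ χ)
  | ball {n : ℕ} (i : Fin n) {φ : Fml (n + 1)} : IsDelta0 φ → IsDelta0 (ball i fun _ => φ)
  | bex {n : ℕ} (i : Fin n) {φ : Fml (n + 1)} : IsDelta0 φ → IsDelta0 (bex i fun _ => φ)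

/-- `Σ₁`-formulas: a block of existential quantifiers followed by a `Δ₀`-formula. -/
inductive IsSigma1 : {n : ℕ} → Fml n → Prop
  | delta0 {n : ℕ} {φ : Fml n} : IsDelta0 φ → IsSigma1 φ
  | ex {n : ℕ} {φ : Fml (n + 1)} : IsSigma1 φ → IsSigma1 (ex fun _ => φ)

/-! ## Set-theoretic notions as formulas -/

/-- `a ⊆ b` -/
def isSubset {n : ℕ} (a b : Fin n) : Fml n := ball a fun z => mem z b.up

/-- `a = ∅` -/
def isEmpty {n : ℕ} (a : Fin n) : Fml n := all fun z => ∼(mem z a.up)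

/-- `p = {x, y}` -/
def isUPair {n : ℕ} (p x y : Fin n) : Fml n :=
  all fun z => mem z p.up ⇔ (eq z x.up ⊔ eq z y.up)

/-- `p = ⟨x, y⟩ = {{x}, {x, y}}` -/
def isOPair {n : ℕ} (p x y : Fin n) : Fml n :=
  all fun z => mem z p.up ⇔ (isUPair z x.up x.up ⊔ isUPair z x.up y.up)

/-- `⟨x, y⟩ ∈ f` -/
def pairMem {n : ℕ} (x y f : Fin n) : Fml n :=
  ex fun p => isOPair p x.up y.up ⊓ mem p f.up

/-- `f` is a function with domain `d`. -/
def isFun {n : ℕ} (f d : Fin n) : Fml n :=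
  (ball f fun p => bex d.up fun x => ex fun y => isOPair p.up.up x.up y) ⊓
  (ball d fun x => ex fun y => pairMem x.up y f.up.up ⊓
    all fun z => pairMem x.up.up z f.up.up.up ⟹ eq z y.up)

/-- `f` is a bijection from `a` onto `b`. -/
def isBij {n : ℕ} (f a b : Fin n) : Fml n :=
  isFun f a ⊓
  (all fun y => mem y b.up ⇔ ex fun x => pairMem x y.up f.up.up) ⊓
  (all fun x => all fun x' => all fun y =>
    pairMem x.up.up y f.up.up.up ⟹ pairMem x'.up y f.up.up.up ⟹ eq x.up.up x'.up)

/-- There is a bijection from `a` onto `b`. -/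
def isEquinum {n : ℕ} (a b : Fin n) : Fml n := ex fun f => isBij f a.up b.up

/-- `p` is the power set of `a`. -/
def isPowerset {n : ℕ} (p a : Fin n) : Fml n := all fun z => mem z p.up ⇔ isSubset z a.up

/-- `s = a ∪ {a}` -/
def isSucc {n : ℕ} (s a : Fin n) : Fml n := all fun z => mem z s.up ⇔ (mem z a.up ⊔ eq z a.up)

/-- `a` is a transitive set. -/
def isTransitive {n : ℕ} (a : Fin n) : Fml n := ball a fun x => isSubset x a.up

/-- `a` is an ordinal: a transitive set of transitive sets. -/
def isOrdinal {n : ℕ} (a : Fin n) : Fml n := isTransitive a ⊓ ball a fun x => isTransitive x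

/-- `a` is a cardinal: an ordinal that is not equinumerous to a smaller one. -/
def isCardinal {n : ℕ} (a : Fin n) : Fml n := isOrdinal a ⊓ ball a fun x => ∼(isEquinum x a.up)

/-- `a` is a nonzero cardinal such that `2 ^ |x| < a` for all `x < a`. -/
def isStrongLimit {n : ℕ} (a : Fin n) : Fml n :=
  isCardinal a ⊓ ∼(isEmpty a) ⊓
  ball a fun x => ex fun p => isPowerset p x.up ⊓ bex a.up.up fun y => isEquinum p.up y

/-- `a` is a nonzero limit ordinal. -/
def isLimitOrdinal {n : ℕ} (a : Fin n) : Fml n :=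
  isOrdinal a ⊓ ∼(isEmpty a) ⊓ ball a fun x => bex a.up fun y => mem x.up y

/-- `a = ω`, the least nonzero limit ordinal. -/
def isOmega {n : ℕ} (a : Fin n) : Fml n := isLimitOrdinal a ⊓ ball a fun x => ∼(isLimitOrdinal x)

/-- `V` is the stage `V_l` of the cumulative hierarchy, where `l` is an ordinal: there is a function
`f` with domain `l + 1` such that `f(α) = ⋃ {𝒫(f(β)) | β < α}` for all `α ≤ l`, and `V = f(l)`. -/
def isStage {n : ℕ} (V l : Fin n) : Fml n :=
  isOrdinal l ⊓
  ex fun d => isSucc d l.up ⊓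
  ex fun f => isFun f d.up ⊓ pairMem l.up.up V.up.up f ⊓
    ball d.up fun α => all fun v => pairMem α.up v f.up.up ⟹
      all fun x => mem x v.up ⇔
        bex α.up.up fun β => ex fun u => pairMem β.up u f.up.up.up.up.up ⊓ isSubset x.up.up u

/-- `s` is a strictly increasing sequence of length `ω` of strong limit cardinals, with
supremum `l`. -/
def isStrongLimitSeq {n : ℕ} (s l : Fin n) : Fml n :=
  (ex fun w => isOmega w ⊓ isFun s.up w) ⊓
  (all fun i => all fun a => pairMem i.up a s.up.up ⟹ isStrongLimit a) ⊓
  (all fun i => all fun a => all fun j => all fun b =>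
    pairMem i.up.up.up a.up.up s.up.up.up.up ⟹ pairMem j.up b s.up.up.up.up ⟹
      mem i.up.up.up j.up ⟹ mem a.up.up b) ⊓
  (all fun x => mem x l.up ⇔ ex fun i => ex fun a => pairMem i.up a s.up.up.up ⊓ mem x.up.up a)

/-! ## The axioms of ZFC -/

/-- The formula `φ`, with the variable `v_(g i)` put in the place of its free variable `i`. -/
def inst {m n : ℕ} (φ : setLang.Formula (Fin m)) (g : Fin m → Fin n) : Fml n :=
  (FirstOrder.Language.BoundedFormula.relabel (fun i => (Sum.inr (g i) : Empty ⊕ Fin n)) φ :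
    setLang.BoundedFormula Empty (n + 0))

def extensionality : setLang.Sentence :=
  all fun x => all fun y => (all fun z => mem z x.up.up ⇔ mem z y.up) ⟹ eq x.up y

def foundation : setLang.Sentence :=
  all fun x => ∼(isEmpty x) ⟹ bex x fun y => ball y fun z => ∼(mem z x.up.up)

def pairing : setLang.Sentence :=
  all fun x => all fun y => ex fun p => isUPair p x.up.up y.up

def union : setLang.Sentence :=
  all fun x => ex fun u => all fun z => mem z u.up ⇔ bex x.up.up fun y => mem z.up y

def powerset : setLang.Sentence :=
  all fun x => ex fun p => isPowerset p x.up

def infinity : setLang.Sentence :=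
  ex fun x => (bex x fun e => isEmpty e) ⊓ ball x fun y => bex x.up fun s => isSucc s y.up

/-- Every set `x` of nonempty sets has a choice function. -/
def choice : setLang.Sentence :=
  all fun x => (ball x fun y => ∼(isEmpty y)) ⟹
    ex fun f => isFun f x.up ⊓ ball x.up fun y => bex y fun z => pairMem y.up z f.up.up

/-- Separation for `φ(p₀, …, pₘ₋₁, z)`: for all parameters `p` and every `x`, the set
`{z ∈ x | φ(p, z)}` exists. -/
def separation {m : ℕ} (φ : setLang.Formula (Fin (m + 1))) : setLang.Sentence :=
  FirstOrder.Language.BoundedFormula.alls (n := m) <|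
    all fun x => ex fun y => all fun z => mem z y.up ⇔
      (mem z x.up.up ⊓ inst φ (Fin.snoc (α := fun _ => Fin (m + 3)) (fun i => i.up.up.up) z))

/-- Replacement for `φ(p₀, …, pₘ₋₁, x, y)`: for all parameters `p`, if `φ(p, x, y)` defines a
(partial) class function `x ↦ y`, then the image of every set under it is a set. -/
def replacement {m : ℕ} (φ : setLang.Formula (Fin (m + 2))) : setLang.Sentence :=
  FirstOrder.Language.BoundedFormula.alls (n := m) <|
    (all fun x => all fun y => all fun z =>
      inst φ (Fin.snoc (α := fun _ => Fin (m + 3))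
        (Fin.snoc (α := fun _ => Fin (m + 3)) (fun i => i.up.up.up) x.up.up) y.up) ⟹
      inst φ (Fin.snoc (α := fun _ => Fin (m + 3))
        (Fin.snoc (α := fun _ => Fin (m + 3)) (fun i => i.up.up.up) x.up.up) z) ⟹
      eq y.up z) ⟹
    all fun a => ex fun b => all fun y => mem y b.up ⇔
      bex a.up.up fun x =>
        inst φ (Fin.snoc (α := fun _ => Fin (m + 4))
          (Fin.snoc (α := fun _ => Fin (m + 4)) (fun i => i.up.up.up.up) x) y.up)

/-- Zermelo–Fraenkel set theory with the axiom of choice. -/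
inductive ZFC : setLang.Theory
  | extensionality : ZFC extensionality
  | foundation : ZFC foundation
  | pairing : ZFC pairing
  | union : ZFC union
  | powerset : ZFC powerset
  | infinity : ZFC infinity
  | choice : ZFC choice
  | separation {m : ℕ} (φ : setLang.Formula (Fin (m + 1))) : ZFC (separation φ)
  | replacement {m : ℕ} (φ : setLang.Formula (Fin (m + 2))) : ZFC (replacement φ)

/-! ## Second-order formulas over `⟨V_λ, ∈⟩` -/

/-- Second-order formulas in the language of set theory, with free second-order variables
`w₀, …, wₘ₋₁` and free first-order variables `v₀, …, vₙ₋₁`. -/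
inductive SOFml : ℕ → ℕ → Type
  | falsum {m n : ℕ} : SOFml m n
  | mem {m n : ℕ} (x y : Fin n) : SOFml m n
  | eq {m n : ℕ} (x y : Fin n) : SOFml m n
  | memSet {m n : ℕ} (x : Fin n) (X : Fin m) : SOFml m n
  | eqSet {m n : ℕ} (X Y : Fin m) : SOFml m n
  | imp {m n : ℕ} (φ χ : SOFml m n) : SOFml m n
  /-- quantification over the elements of the structure; the new variable is `vₙ` -/
  | all₁ {m n : ℕ} (φ : SOFml m (n + 1)) : SOFml m n
  /-- quantification over the subsets of the structure; the new variable is `wₘ` -/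
  | all₂ {m n : ℕ} (φ : SOFml (m + 1) n) : SOFml m n

namespace SOFml

def neg {m n : ℕ} (φ : SOFml m n) : SOFml m n := φ.imp falsum

def ex₂ {m n : ℕ} (φ : SOFml (m + 1) n) : SOFml m n := φ.neg.all₂.neg

/-- The formula has no second-order quantifiers. -/
def IsFirstOrder : {m n : ℕ} → SOFml m n → Prop
  | _, _, falsum => True
  | _, _, mem _ _ => True
  | _, _, eq _ _ => True
  | _, _, memSet _ _ => True
  | _, _, eqSet _ _ => True
  | _, _, imp φ χ => φ.IsFirstOrder ∧ χ.IsFirstOrder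
  | _, _, all₁ φ => φ.IsFirstOrder
  | _, _, all₂ _ => False

/-- `Π¹₁`: a block of universal second-order quantifiers in front of a formula without second-order
quantifiers. -/
inductive IsPi11 : {m n : ℕ} → SOFml m n → Prop
  | base {m n : ℕ} {φ : SOFml m n} : φ.IsFirstOrder → IsPi11 φ
  | all {m n : ℕ} {φ : SOFml (m + 1) n} : IsPi11 φ → IsPi11 φ.all₂

/-- `Σ¹₂`: a block of existential second-order quantifiers in front of a `Π¹₁`-formula. -/
inductive IsSigma12 : {m n : ℕ} → SOFml m n → Prop
  | base {m n : ℕ} {φ : SOFml m n} : IsPi11 φ → IsSigma12 φ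
  | ex {m n : ℕ} {φ : SOFml (m + 1) n} : IsSigma12 φ → IsSigma12 φ.ex₂

/-- The first-order formula of set theory which says that `⟨V, ∈⟩ ⊨ φ(F₀, …, Fₘ₋₁; G₀, …, Gₙ₋₁)`
in full second-order semantics: first-order variables range over the elements of `V`, second-order
variables over the subsets of `V`. -/
def satIn : {m n N : ℕ} → SOFml m n → Fin N → (Fin m → Fin N) → (Fin n → Fin N) → Fml N
  | _, _, _, falsum, _, _, _ => ⊥
  | _, _, _, mem x y, _, _, G => SetThy.mem (G x) (G y)
  | _, _, _, eq x y, _, _, G => SetThy.eq (G x) (G y)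
  | _, _, _, memSet x X, _, F, G => SetThy.mem (G x) (F X)
  | _, _, _, eqSet X Y, _, F, _ => SetThy.eq (F X) (F Y)
  | _, _, _, imp φ χ, V, F, G => φ.satIn V F G ⟹ χ.satIn V F G
  | _, n, N, all₁ φ, V, F, G => SetThy.all fun x => SetThy.mem x V.up ⟹
      φ.satIn V.up (fun i => (F i).up)
        (Fin.snoc (α := fun _ : Fin (n + 1) => Fin (N + 1)) (fun i => (G i).up) x)
  | m, _, N, all₂ φ, V, F, G => SetThy.all fun X => isSubset X V.up ⟹
      φ.satIn V.up
        (Fin.snoc (α := fun _ : Fin (m + 1) => Fin (N + 1)) (fun i => (F i).up) X)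
        (fun i => (G i).up)

end SOFml

/-- The sentence of set theory which says: whenever `s` is a strictly increasing `ω`-sequence of
strong limit cardinals with supremum `l`, `V = V_l`, and `A₀, …, Aₖ₋₁ ∈ V_(l+1)` (that is,
`Aᵢ ⊆ V_l`), then `φ(A₀, …, Aₖ₋₁, V, s)` holds if and only if `⟨V, ∈⟩ ⊨ ψ(A₀, …, Aₖ₋₁)`. -/
noncomputable def translationSentence {k : ℕ} (ψ : SOFml k 0) (φ : Fml (k + 2)) :
    setLang.Sentence :=
  let A : Fin k → Fin (k + 2) := fun i => i.up.up
  let V : Fin (k + 2) := (Fin.last k).up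
  let s : Fin (k + 2) := Fin.last (k + 1)
  FirstOrder.Language.BoundedFormula.alls (n := k + 2) <|
    (ex fun l => isStrongLimitSeq s.up l ⊓ isStage V.up l) ⟹
    (FirstOrder.Language.BoundedFormula.iInf fun i => isSubset (A i) V) ⟹
    (φ ⇔ ψ.satIn V A Fin.elim0)

end SetThy

namespace SetThy

open FirstOrder.Language

/-! ## Membership in a structure, and realization of the basic formulas -/

/-! The negation of a `Π¹₁`-statement over `V = V_λ` asks for a subset of `V`. Because `λ` has
cofinality `ω`, and `ω ∈ V`, the search for this subset is the search for an infinite branch through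
a tree of height `ω`. The nodes are subsets `z` of a level `u`, one of the stages `V_(λ_n)`, which
look correct as far as `u` can see. The `Π¹₁`-statement is true iff there is no branch, iff the tree
is well-founded, iff it has a ranking that decreases along `∈`. Being such a ranking is `Δ₀`, so
`Π¹₁`-truth is `Σ₁`. Existential second-order quantifiers in front become quantifiers over sets `Y ⊆
V`.

To obtain the tree, the first-order part is put into closed form. `Rep P` says that `P` holds iff
some `Z ⊆ V` meets a `Δ₀`-condition at all levels, where the condition at `u` sees only the parts of
`Z` and of the second-order parameters inside `u`. Such predicates are closed under `∀ x ∈ V`, since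
one `Z` can code a family of witnesses (`Rep.all`), and under `∃ Y ⊆ V` (`Rep.ex₂`). The crux is `∃
x ∈ V`, which is not a closed condition by itself. In `Rep.nonempty`, `Z` names the index of a level
in which an element occurs. All indices lie in one element `W` of `V`, so a single level can already
check that some index has been named. This is how the small cofinality enters.

The `Σ₁`-formula also guesses the levels, constrained only by the `Δ₀`-property `Sys`. A ranking
over any such system excludes a branch, by foundation (`Cert.not_exists`). Conversely, over the true
tower of stages (`exists_tower`), an unranked tree has a descending `ω`-sequence of nodes, whose
union is a branch (`exists_cert`).

All arguments take place inside an arbitrary model of ZFC. `Df` provides the definability needed for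
separation and replacement there; `D0` and `S1` keep track of formulas that are the same for all
structures. -/

/-- The membership relation of a structure for the language of set theory. -/
def E {M : Type} [setLang.Structure M] (a b : M) : Prop :=
  FirstOrder.Language.Structure.RelMap memSym ![a, b]

infix:50 " ε " => E

section Realize

variable {M : Type} [setLang.Structure M] {α : Type} {n : ℕ} (v : Empty → M) (xs : Fin n → M)

@[simp] theorem realize_mem (i j : Fin n) : (mem i j).Realize v xs ↔ xs i ε xs j := by
  simp [mem, E, BoundedFormula.realize_rel₂, vr]

@[simp] theorem realize_eq (i j : Fin n) : (eq i j).Realize v xs ↔ xs i = xs j := by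
  simp [eq, vr]

@[simp] theorem realize_all (f : Fin (n + 1) → Fml (n + 1)) :
    (all f).Realize v xs ↔ ∀ x, (f (Fin.last n)).Realize v (Fin.snoc xs x) := by
  simp [all]

@[simp] theorem realize_ex (f : Fin (n + 1) → Fml (n + 1)) :
    (ex f).Realize v xs ↔ ∃ x, (f (Fin.last n)).Realize v (Fin.snoc xs x) := by
  simp [ex]

@[simp] theorem realize_ball (i : Fin n) (f : Fin (n + 1) → Fml (n + 1)) :
    (ball i f).Realize v xs ↔ ∀ x, x ε xs i → (f (Fin.last n)).Realize v (Fin.snoc xs x) := by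
  simp [ball]

@[simp] theorem realize_bex (i : Fin n) (f : Fin (n + 1) → Fml (n + 1)) :
    (bex i f).Realize v xs ↔ ∃ x, x ε xs i ∧ (f (Fin.last n)).Realize v (Fin.snoc xs x) := by
  simp [bex]

@[simp] theorem realize_inst {m : ℕ} (φ : setLang.Formula (Fin m)) (g : Fin m → Fin n) :
    (inst φ g).Realize v xs ↔ φ.Realize (fun i => xs (g i)) := by
  unfold inst
  refine (BoundedFormula.realize_relabel (n := 0)).trans ?_
  unfold Formula.Realize
  apply iff_of_eq
  congr 1
  exact Subsingleton.elim _ _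

end Realize

/-! ## Definability with parameters -/

section Definable

/-- Prepend a value to an environment. -/
def cons {M : Type} (x : M) (e : ℕ → M) : ℕ → M
  | 0 => x
  | n + 1 => e n

variable {M : Type} [setLang.Structure M]

/-- The term `t` is a variable or a constant. -/
class Tm (t : (ℕ → M) → M) : Prop where
  out : ∃ g : M ⊕ ℕ, ∀ e, t e = Sum.elim id e g

instance Tm.const (c : M) : Tm (fun _ => c) := ⟨Sum.inl c, fun _ => rfl⟩

instance Tm.var (k : ℕ) : Tm (M := M) (fun e => e k) := ⟨Sum.inr k, fun _ => rfl⟩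

/-- The predicate `P` on environments is definable with parameters. -/
class Df (P : (ℕ → M) → Prop) : Prop where
  out : ∃ φ : setLang.Formula (M ⊕ ℕ), ∀ e, φ.Realize (Sum.elim id e) ↔ P e

theorem Df.congr {P Q : (ℕ → M) → Prop} [h : Df P] (hPQ : ∀ e, Q e ↔ P e) : Df Q := by
  obtain ⟨φ, hφ⟩ := h.out
  exact ⟨φ, fun e => (hφ e).trans (hPQ e).symm⟩

instance Df.mem {s t : (ℕ → M) → M} [hs : Tm s] [ht : Tm t] : Df (fun e => s e ε t e) := by
  obtain ⟨g, hg⟩ := hs.out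
  obtain ⟨g', hg'⟩ := ht.out
  refine ⟨Relations.formula₂ memSym (Term.var g) (Term.var g'), fun e => ?_⟩
  rw [Formula.realize_rel₂, hg, hg']
  rfl

instance Df.eq {s t : (ℕ → M) → M} [hs : Tm s] [ht : Tm t] : Df (fun e => s e = t e) := by
  obtain ⟨g, hg⟩ := hs.out
  obtain ⟨g', hg'⟩ := ht.out
  refine ⟨(Term.var g).equal (Term.var g'), fun e => ?_⟩
  rw [Formula.realize_equal, hg, hg']
  rfl

instance Df.not {P : (ℕ → M) → Prop} [h : Df P] : Df (fun e => ¬ P e) := by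
  obtain ⟨φ, hφ⟩ := h.out
  exact ⟨φ.not, fun e => by rw [Formula.realize_not, hφ]⟩

instance Df.and {P Q : (ℕ → M) → Prop} [h : Df P] [h' : Df Q] : Df (fun e => P e ∧ Q e) := by
  obtain ⟨φ, hφ⟩ := h.out
  obtain ⟨χ, hχ⟩ := h'.out
  exact ⟨φ ⊓ χ, fun e => by rw [Formula.realize_inf, hφ, hχ]⟩

instance Df.or {P Q : (ℕ → M) → Prop} [h : Df P] [h' : Df Q] : Df (fun e => P e ∨ Q e) :=
  Df.congr (P := fun e => ¬ (¬ P e ∧ ¬ Q e)) fun e => by tauto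

instance Df.imp {P Q : (ℕ → M) → Prop} [h : Df P] [h' : Df Q] : Df (fun e => P e → Q e) :=
  Df.congr (P := fun e => ¬ (P e ∧ ¬ Q e)) fun e => by tauto

instance Df.iff {P Q : (ℕ → M) → Prop} [h : Df P] [h' : Df Q] : Df (fun e => P e ↔ Q e) :=
  Df.congr (P := fun e => (P e → Q e) ∧ (Q e → P e)) fun e => by tauto

instance Df.false : Df (M := M) (fun _ => False) := ⟨⊥, fun e => by simp⟩

/-- Environments follow de Bruijn indices: under a quantifier the bound variable is entry 0 and the
old entries are shifted by one. Instance search can thus build the formula by recursion on the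
predicate. -/
instance Df.all {P : (ℕ → M) → M → Prop} [h : Df (fun e => P (fun n => e (n + 1)) (e 0))] :
    Df (fun e => ∀ x, P e x) := by
  obtain ⟨φ, hφ⟩ := h.out
  let g : M ⊕ ℕ → (M ⊕ ℕ) ⊕ Fin 1 := Sum.elim (fun c => Sum.inl (Sum.inl c))
    (fun k => Nat.casesOn k (Sum.inr 0) fun k => Sum.inl (Sum.inr k))
  refine ⟨(BoundedFormula.relabel (n := 1) g φ : setLang.BoundedFormula (M ⊕ ℕ) 1).all,
    fun e => ?_⟩
  refine (BoundedFormula.realize_all).trans (forall_congr' fun x => ?_)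
  refine (BoundedFormula.realize_relabel (n := 0) (m := 1)).trans ?_
  rw [← show _ ↔ P e x from hφ (cons x e)]
  unfold Formula.Realize
  apply iff_of_eq
  congr 1
  · funext a
    rcases a with c | k
    · rfl
    · cases k <;> rfl
  · exact Subsingleton.elim _ _

instance Df.ex {P : (ℕ → M) → M → Prop} [h : Df (fun e => P (fun n => e (n + 1)) (e 0))] :
    Df (fun e => ∃ x, P e x) :=
  Df.congr (P := fun e => ¬ ∀ x, ¬ P e x) fun e => by simp


theorem Df.comp {P : (ℕ → M) → Prop} [h : Df P] (T : ℕ → (ℕ → M) → M) [hT : ∀ k, Tm (T k)] :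
    Df (fun e => P fun k => T k e) := by
  obtain ⟨φ, hφ⟩ := h.out
  choose g hg using fun k => (hT k).out
  refine ⟨φ.relabel (Sum.elim Sum.inl g), fun e => ?_⟩
  rw [Formula.realize_relabel, ← hφ]
  apply iff_of_eq
  congr 1
  funext a
  rcases a with c | k
  · rfl
  · exact (hg k e).symm

/-- Definability of a relation is assumed for entries 1 and 0 only; inside larger formulas it is
needed at other variables and at constants. -/
theorem Df.subst₂ (Q : M → M → Prop) [Df (fun e => Q (e 1) (e 0))] (s t : (ℕ → M) → M)
    [hs : Tm s] [ht : Tm t] : Df (fun e => Q (s e) (t e)) :=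
  Df.comp (P := fun e => Q (e 1) (e 0)) (fun k => if k = 0 then t else s)
    (hT := fun k => by split_ifs <;> assumption)

end Definable

/-! ## Models of ZFC -/

/-- `M` is a model of ZFC. -/
class ZFCM (M : Type) [setLang.Structure M] : Prop where
  models : M ⊨ ZFC

section Axioms

variable {M : Type} [setLang.Structure M]

/-- `a ⊆ b` -/
def Sub (a b : M) : Prop := ∀ x, x ε a → x ε b

/-- `p = {x, y}` -/
def IsUP (p x y : M) : Prop := ∀ z, z ε p ↔ z = x ∨ z = y

/-- `p = ⟨x, y⟩` -/
def IsOP (p x y : M) : Prop := ∀ z, z ε p ↔ IsUP z x x ∨ IsUP z x y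

@[simp] theorem realize_isSubset {n : ℕ} (v : Empty → M) (xs : Fin n → M) (a b : Fin n) :
    (isSubset a b).Realize v xs ↔ Sub (xs a) (xs b) := by
  simp [isSubset, Sub]

@[simp] theorem realize_isEmpty {n : ℕ} (v : Empty → M) (xs : Fin n → M) (a : Fin n) :
    (isEmpty a).Realize v xs ↔ ∀ x, ¬ x ε xs a := by
  simp [isEmpty]

@[simp] theorem realize_isUPair {n : ℕ} (v : Empty → M) (xs : Fin n → M) (p x y : Fin n) :
    (isUPair p x y).Realize v xs ↔ IsUP (xs p) (xs x) (xs y) := by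
  simp [isUPair, IsUP]

variable [hM : ZFCM M]

theorem realize_axiom {φ : setLang.Sentence} (h : ZFC φ) : M ⊨ φ :=
  hM.models.realize_of_mem φ h

theorem ext {x y : M} (h : ∀ z, z ε x ↔ z ε y) : x = y := by
  have := realize_axiom (M := M) ZFC.extensionality
  simp [extensionality, Sentence.Realize, Formula.Realize, Fin.snoc] at this
  exact this x y h

theorem exists_minimal (x : M) (h : ∃ y, y ε x) : ∃ y, y ε x ∧ ∀ z, z ε y → ¬ z ε x := by
  have := realize_axiom (M := M) ZFC.foundation
  simp [foundation, Sentence.Realize, Formula.Realize, Fin.snoc] at this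
  obtain ⟨y, hy⟩ := h
  exact this x y hy

theorem exists_pair (x y : M) : ∃ p, IsUP p x y := by
  have := realize_axiom (M := M) ZFC.pairing
  simp [pairing, Sentence.Realize, Formula.Realize, Fin.snoc] at this
  exact this x y

theorem exists_union (x : M) : ∃ u, ∀ z, z ε u ↔ ∃ y, y ε x ∧ z ε y := by
  have := realize_axiom (M := M) ZFC.union
  simp [union, Sentence.Realize, Formula.Realize, Fin.snoc] at this
  exact this x

theorem exists_powerset (x : M) : ∃ p, ∀ z, z ε p ↔ Sub z x := by
  have := realize_axiom (M := M) ZFC.powerset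
  simp [powerset, isPowerset, Sentence.Realize, Formula.Realize, Fin.snoc] at this
  exact this x

-- The axiom schemes allow finitely many parameters, and a formula has finitely many free variables.
-- Each one gets a parameter slot, except that entries 0 and 1 are sent to the two distinguished
-- variables; entries from 2 on have the value `c`.
omit hM in
theorem exists_formula (P : (ℕ → M) → Prop) [h : Df P] (c : M) :
    ∃ (m : ℕ) (χ : setLang.Formula (Fin (m + 2))) (p : Fin m → M), ∀ x y,
      χ.Realize (Fin.snoc (α := fun _ => M) (Fin.snoc (α := fun _ => M) p x) y) ↔
        P (cons y (cons x fun _ => c)) := by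
  classical
  obtain ⟨φ, hφ⟩ := h.out
  let s := φ.freeVarFinset
  let q := s.equivFin
  let f : s → Fin (s.card + 2) := fun a =>
    if a.1 = Sum.inr 0 then Fin.last _ else
      if a.1 = Sum.inr 1 then (Fin.last s.card).castSucc else (q a).castSucc.castSucc
  refine ⟨s.card, φ.restrictFreeVar f, fun i => Sum.elim id (fun _ => c) (q.symm i).1,
    fun x y => ?_⟩
  rw [← hφ]
  unfold Formula.Realize
  apply BoundedFormula.realize_restrictFreeVar
  rintro ⟨a, ha⟩
  simp only [f]
  split_ifs with h0 h1
  · subst h0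
    simp [cons]
  · subst h1
    simp [cons]
  · simp only [Fin.snoc_castSucc, Equiv.symm_apply_apply]
    rcases a with a | k
    · rfl
    · rcases k with _ | _ | k
      · simp at h0
      · simp at h1
      · rfl

theorem sep (Q : M → Prop) [h : Df (fun e => Q (e 0))] (a : M) :
    ∃ b, ∀ z, z ε b ↔ z ε a ∧ Q z := by
  obtain ⟨m, χ, p, hχ⟩ := exists_formula (fun e => Q (e 0)) a
  have := BoundedFormula.realize_alls.1 (realize_axiom (M := M) (ZFC.separation χ))
    (Fin.snoc (α := fun _ => M) p a) a
  simp at this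
  obtain ⟨b, hb⟩ := this
  refine ⟨b, fun z => (hb z).trans (and_congr_right fun _ => ?_)⟩
  refine Iff.trans (iff_of_eq ?_) (hχ a z)
  unfold Formula.Realize
  congr 1
  funext i
  refine Fin.lastCases ?_ (fun i => ?_) i
  · simp
  · simp

theorem exists_replacement (Q : M → M → Prop) [h : Df (fun e => Q (e 1) (e 0))]
    (hQ : ∀ x y z, Q x y → Q x z → y = z) (a : M) :
    ∃ b, ∀ y, y ε b ↔ ∃ x, x ε a ∧ Q x y := by
  obtain ⟨m, χ, p, hχ⟩ := exists_formula (fun e => Q (e 1) (e 0)) a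
  have key : ∀ x y (w : Fin (m + 2) → M), (∀ i : Fin m, w i.castSucc.castSucc = p i) →
      w (Fin.last m).castSucc = x → w (Fin.last _) = y →
      (χ.Realize w ↔ Q x y) := by
    intro x y w hp hx hy
    refine Iff.trans (iff_of_eq ?_) (hχ x y)
    unfold Formula.Realize
    congr 1
    funext i
    refine Fin.lastCases ?_ (fun i => ?_) i
    · simpa using hy
    · refine Fin.lastCases ?_ (fun i => ?_) i
      · simpa using hx
      · simpa using hp i
  have := BoundedFormula.realize_alls.1 (realize_axiom (M := M) (ZFC.replacement χ)) p
  simp [-realize_inst] at this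
  obtain ⟨b, hb⟩ := this (fun x y z hy hz => by
    rw [realize_inst, key x] at hy hz
    · exact hQ x y z hy hz
    all_goals simp) a
  refine ⟨b, fun y => (hb y).trans (exists_congr fun x => and_congr_right fun _ => ?_)⟩
  rw [realize_inst, key x y] <;> simp

end Axioms
/-! ## Uniform `Δ₀`-definability -/

/-- `Δ₀`-formulas whose variables are de Bruijn indices. -/
inductive DF : Type
  | fls : DF
  | mem (i j : ℕ) : DF
  | eq (i j : ℕ) : DF
  | imp (φ χ : DF) : DF
  | ball (i : ℕ) (φ : DF) : DF

namespace DF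

/-- Satisfaction of a formula in an environment. -/
def eval {M : Type} [setLang.Structure M] : DF → (ℕ → M) → Prop
  | fls, _ => False
  | mem i j, e => e i ε e j
  | eq i j, e => e i = e j
  | imp φ χ, e => φ.eval e → χ.eval e
  | ball i φ, e => ∀ x, x ε e i → φ.eval (cons x e)

/-- Translation to formulas of set theory, along a renaming of the variables. -/
def toFml : DF → {N : ℕ} → (ℕ → Fin N) → Fml N
  | fls, _, _ => ⊥
  | mem i j, _, g => SetThy.mem (g i) (g j)
  | eq i j, _, g => SetThy.eq (g i) (g j)
  | imp φ χ, _, g => φ.toFml g ⟹ χ.toFml g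
  | ball i φ, N, g => SetThy.ball (g i) fun _ => φ.toFml (cons (Fin.last N) fun k => (g k).castSucc)

/-- Substitution of variables. -/
def rename : DF → (ℕ → ℕ) → DF
  | fls, _ => fls
  | mem i j, ρ => mem (ρ i) (ρ j)
  | eq i j, ρ => eq (ρ i) (ρ j)
  | imp φ χ, ρ => imp (φ.rename ρ) (χ.rename ρ)
  | ball i φ, ρ => ball (ρ i) (φ.rename (cons 0 fun k => ρ k + 1))

theorem eval_rename {M : Type} [setLang.Structure M] (φ : DF) (ρ : ℕ → ℕ) (e : ℕ → M) :
    (φ.rename ρ).eval e ↔ φ.eval fun k => e (ρ k) := by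
  induction φ generalizing ρ e with
  | fls => exact Iff.rfl
  | mem i j => exact Iff.rfl
  | eq i j => exact Iff.rfl
  | imp φ χ h h' => exact imp_congr (h _ _) (h' _ _)
  | ball i φ h =>
    refine forall_congr' fun x => imp_congr_right fun _ => (h _ _).trans (iff_of_eq ?_)
    congr 1
    funext k
    cases k <;> rfl

theorem isDelta0_toFml (φ : DF) {N : ℕ} (g : ℕ → Fin N) : IsDelta0 (φ.toFml g) := by
  induction φ generalizing N with
  | fls => exact .falsum
  | mem i j => exact .mem _ _
  | eq i j => exact .eq _ _
  | imp φ χ h h' => exact .imp (h _) (h' _)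
  | ball i φ h => exact .ball _ (h _)

theorem realize_toFml {M : Type} [setLang.Structure M] (φ : DF) {N : ℕ} (g : ℕ → Fin N)
    (v : Empty → M) (xs : Fin N → M) :
    (φ.toFml g).Realize v xs ↔ φ.eval fun k => xs (g k) := by
  induction φ generalizing N with
  | fls => exact Iff.rfl
  | mem i j => simp [toFml, eval]
  | eq i j => simp [toFml, eval]
  | imp φ χ h h' => simp [toFml, eval, h, h']
  | ball i φ h =>
    simp only [toFml, eval, realize_ball, h]
    refine forall_congr' fun x => imp_congr_right fun _ => iff_of_eq (congrArg _ ?_)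
    funext k
    cases k <;> simp [cons]

theorem df_eval {M : Type} [setLang.Structure M] (φ : DF) (T : ℕ → (ℕ → M) → M)
    [hT : ∀ k, Tm (T k)] : Df (fun e => φ.eval fun k => T k e) := by
  induction φ generalizing T with
  | fls => exact Df.false
  | mem i j => exact Df.mem
  | eq i j => exact Df.eq
  | imp φ χ h h' =>
    have := h T
    have := h' T
    exact Df.imp
  | ball i φ h =>
    have hs : ∀ k, Tm (fun e : ℕ → M => T k fun n => e (n + 1)) := fun k => by
      obtain ⟨g, hg⟩ := (hT k).out
      rcases g with c | j
      · exact ⟨Sum.inl c, fun e => hg _⟩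
      · exact ⟨Sum.inr (j + 1), fun e => hg _⟩
    have hc : ∀ k, Tm ((cons (fun e => e 0) fun k e => T k fun n => e (n + 1)) k :
        (ℕ → M) → M) := fun k => by
      cases k
      · exact Tm.var 0
      · exact hs _
    have := h (cons (fun e => e 0) fun k e => T k fun n => e (n + 1))
    refine Df.all (P := fun e x => x ε T i e → φ.eval (cons x fun k => T k e)) (h := ?_)
    refine Df.congr (P := fun e => (e 0 ε T i fun n => e (n + 1)) → _) (h := Df.imp (h' := this))
      fun e => imp_congr_right fun _ => iff_of_eq (congrArg _ ?_)
    funext k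
    cases k <;> rfl

end DF

/-- The predicate `P` on environments is `Δ₀`-definable, uniformly in the structure. -/
class D0 (P : ∀ (M : Type) [setLang.Structure M], (ℕ → M) → Prop) : Prop where
  out : ∃ φ : DF, ∀ (M : Type) [setLang.Structure M] (e : ℕ → M), φ.eval e ↔ P M e

section D0

variable {P Q : ∀ (M : Type) [setLang.Structure M], (ℕ → M) → Prop}

theorem D0.congr [h : D0 P] (hPQ : ∀ (M : Type) [setLang.Structure M] e, Q M e ↔ P M e) :
    D0 Q := by
  obtain ⟨φ, hφ⟩ := h.out
  exact ⟨φ, fun M _ e => (hφ M e).trans (hPQ M e).symm⟩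

theorem D0.comp (h : D0 P) (ρ : ℕ → ℕ) : D0 (fun M _ e => P M fun k => e (ρ k)) := by
  obtain ⟨φ, hφ⟩ := h.out
  exact ⟨φ.rename ρ, fun M _ e => (φ.eval_rename ρ e).trans (hφ M _)⟩

instance D0.mem (i j : ℕ) : D0 (fun _ _ e => e i ε e j) := ⟨.mem i j, fun _ _ _ => Iff.rfl⟩

instance D0.eq (i j : ℕ) : D0 (fun _ _ e => e i = e j) := ⟨.eq i j, fun _ _ _ => Iff.rfl⟩

instance D0.false : D0 (fun _ _ _ => False) := ⟨.fls, fun _ _ _ => Iff.rfl⟩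

instance D0.imp [h : D0 P] [h' : D0 Q] : D0 (fun M _ e => P M e → Q M e) := by
  obtain ⟨φ, hφ⟩ := h.out
  obtain ⟨χ, hχ⟩ := h'.out
  exact ⟨.imp φ χ, fun M _ e => imp_congr (hφ M e) (hχ M e)⟩

instance D0.not [h : D0 P] : D0 (fun M _ e => ¬ P M e) :=
  D0.congr (P := fun M _ e => P M e → False) fun _ _ _ => Iff.rfl

instance D0.and [h : D0 P] [h' : D0 Q] : D0 (fun M _ e => P M e ∧ Q M e) :=
  D0.congr (P := fun M _ e => ¬ (P M e → ¬ Q M e)) fun _ _ _ => by tauto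

instance D0.or [h : D0 P] [h' : D0 Q] : D0 (fun M _ e => P M e ∨ Q M e) :=
  D0.congr (P := fun M _ e => ¬ P M e → Q M e) fun _ _ _ => by tauto

instance D0.iff [h : D0 P] [h' : D0 Q] : D0 (fun M _ e => P M e ↔ Q M e) :=
  D0.congr (P := fun M _ e => (P M e → Q M e) ∧ (Q M e → P M e)) fun _ _ _ => by tauto

instance D0.ball {P : ∀ (M : Type) [setLang.Structure M], (ℕ → M) → M → Prop} (i : ℕ)
    [h : D0 (fun M _ e => P M (fun n => e (n + 1)) (e 0))] :
    D0 (fun M _ e => ∀ x, x ε e i → P M e x) := by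
  obtain ⟨φ, hφ⟩ := h.out
  exact ⟨.ball i φ, fun M _ e => forall_congr' fun x => imp_congr_right fun _ =>
    hφ M (cons x e)⟩

instance D0.bex {P : ∀ (M : Type) [setLang.Structure M], (ℕ → M) → M → Prop} (i : ℕ)
    [h : D0 (fun M _ e => P M (fun n => e (n + 1)) (e 0))] :
    D0 (fun M _ e => ∃ x, x ε e i ∧ P M e x) :=
  D0.congr (P := fun M _ e => ¬ ∀ x, x ε e i → ¬ P M e x) fun _ _ _ => by simp

/-! ### Predicates with finite vectors of parameters -/

/-- The vector `F` consists of variables. -/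
class VTm {m : ℕ} (F : ∀ M : Type, (ℕ → M) → Fin m → M) : Prop where
  out : ∃ g : Fin m → ℕ, ∀ M e, F M e = fun j => e (g j)

instance VTm.var {m : ℕ} (g : Fin m → ℕ) : VTm (fun _ e j => e (g j)) := ⟨g, fun _ _ => rfl⟩

instance VTm.snoc {m : ℕ} {F : ∀ M : Type, (ℕ → M) → Fin m → M} [h : VTm F] (k : ℕ) :
    VTm (fun M e => Fin.snoc (α := fun _ => M) (F M e) (e k)) := by
  obtain ⟨g, hg⟩ := h.out
  refine ⟨Fin.snoc (α := fun _ => ℕ) g k, fun M e => ?_⟩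
  rw [hg]
  funext j
  refine Fin.lastCases ?_ (fun j => ?_) j <;> simp

instance VTm.init {m : ℕ} {F : ∀ M : Type, (ℕ → M) → Fin (m + 1) → M} [h : VTm F] :
    VTm (fun M e => Fin.init (α := fun _ => M) (F M e)) := by
  obtain ⟨g, hg⟩ := h.out
  exact ⟨fun j => g j.castSucc, fun M e => by rw [hg]; rfl⟩

end D0

/-- Predicates of four parameters `V, C, W, U`, of `m` subsets of `V`, of `n` elements of `V`, and of
two more sets. -/
abbrev Rel (m n : ℕ) : Type 1 := ∀ (M : Type) [setLang.Structure M],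
  M → M → M → M → (Fin m → M) → (Fin n → M) → M → M → Prop

/-- `Δ₀`-definability of a predicate. -/
class D0R {m n : ℕ} (R : Rel m n) : Prop where
  out : ∀ (v c w q : ℕ) (F : Fin m → ℕ) (G : Fin n → ℕ) (z u : ℕ),
    D0 (fun M _ e => R M (e v) (e c) (e w) (e q) (fun j => e (F j)) (fun j => e (G j)) (e z) (e u))

instance D0R.d0 {m n : ℕ} {R : Rel m n} [h : D0R R] (v c w q z u : ℕ)
    {F : ∀ M : Type, (ℕ → M) → Fin m → M} [hF : VTm F]
    {G : ∀ M : Type, (ℕ → M) → Fin n → M} [hG : VTm G] :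
    D0 (fun M _ e => R M (e v) (e c) (e w) (e q) (F M e) (G M e) (e z) (e u)) := by
  obtain ⟨f, hf⟩ := hF.out
  obtain ⟨g, hg⟩ := hG.out
  simp only [hf, hg]
  exact h.out ..

/-- The vector `F` consists of variables and constants. -/
class VDf {M : Type} {m : ℕ} (F : (ℕ → M) → Fin m → M) : Prop where
  out : ∀ j, Tm fun e => F e j

instance VDf.const {M : Type} {m : ℕ} (F : Fin m → M) : VDf (fun _ => F) := ⟨fun _ => Tm.const _⟩

instance VDf.snoc {M : Type} {m : ℕ} {F : (ℕ → M) → Fin m → M} [h : VDf F] {t : (ℕ → M) → M}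
    [ht : Tm t] : VDf (fun e => Fin.snoc (α := fun _ => M) (F e) (t e)) := by
  refine ⟨fun j => Fin.lastCases ?_ (fun j => ?_) j⟩
  · simpa using ht
  · simpa using h.out j

/-- An environment with given entries. -/
def layout {M : Type} {m n : ℕ} (v c w q z u : M) (F : Fin m → M) (G : Fin n → M) : ℕ → M :=
  cons v <| cons c <| cons w <| cons q <| cons z <| cons u fun k =>
    if h : k < m then F ⟨k, h⟩ else if h : k - m < n then G ⟨k - m, h⟩ else v

/-- Makes a uniform `Δ₀`-predicate available to separation and choice inside one model. The
environment `layout` holds the six single parameters first, then `F` from entry 6 on, then `G`. -/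
instance D0R.df {M : Type} [setLang.Structure M] {m n : ℕ} {R : Rel m n} [h : D0R R]
    {v c w q z u : (ℕ → M) → M} [Tm v] [Tm c] [Tm w] [Tm q] [Tm z] [Tm u]
    {F : (ℕ → M) → Fin m → M} [hF : VDf F] {G : (ℕ → M) → Fin n → M} [hG : VDf G] :
    Df (fun e => R M (v e) (c e) (w e) (q e) (F e) (G e) (z e) (u e)) := by
  obtain ⟨φ, hφ⟩ := (h.out 0 1 2 3 (fun j => j + 6) (fun j => m + j + 6) 4 5).out
  let T : ℕ → (ℕ → M) → M := fun k e => layout (v e) (c e) (w e) (q e) (z e) (u e) (F e) (G e) k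
  have hT : ∀ k, Tm (T k) := by
    intro k
    rcases k with _ | _ | _ | _ | _ | _ | k
    any_goals assumption
    simp only [T, layout, cons]
    split_ifs with h1 h2
    · exact hF.out _
    · exact hG.out _
    · assumption
  have := φ.df_eval T
  refine Df.congr (h := this) fun e => ?_
  rw [hφ]
  apply iff_of_eq
  congr 1
  · funext j
    simp [T, layout, cons]
  · funext j
    simp [T, layout, cons]

/-! ## Uniform `Σ₁`-definability -/

/-- The predicates obtained from `Δ₀`-predicates by existential quantification. -/
inductive S1 : (∀ (M : Type) [setLang.Structure M], (ℕ → M) → Prop) → Prop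
  | d0 {P} [D0 P] : S1 P
  | ex {P : ∀ (M : Type) [setLang.Structure M], (ℕ → M) → M → Prop} :
      S1 (fun M _ e => P M (fun n => e (n + 1)) (e 0)) → S1 (fun M _ e => ∃ x, P M e x)

theorem D0.exists_fml {P : ∀ (M : Type) [setLang.Structure M], (ℕ → M) → Prop} [h : D0 P] {N : ℕ} (g : ℕ → Fin N) :
    ∃ φ : Fml N, IsDelta0 φ ∧ ∀ (M : Type) [setLang.Structure M] (v : Empty → M) xs,
      φ.Realize v xs ↔ P M fun k => xs (g k) := by
  obtain ⟨φ, hφ⟩ := h.out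
  exact ⟨φ.toFml g, φ.isDelta0_toFml g, fun M _ v xs => (φ.realize_toFml g v xs).trans (hφ M _)⟩

theorem S1.exists_fml {P : ∀ (M : Type) [setLang.Structure M], (ℕ → M) → Prop} (h : S1 P) {N : ℕ} (g : ℕ → Fin N) :
    ∃ φ : Fml N, IsSigma1 φ ∧ ∀ (M : Type) [setLang.Structure M] (v : Empty → M) xs,
      φ.Realize v xs ↔ P M fun k => xs (g k) := by
  induction h generalizing N with
  | @d0 P _ =>
    obtain ⟨φ, h, h'⟩ := D0.exists_fml (P := P) g
    exact ⟨φ, .delta0 h, h'⟩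
  | @ex P _ ih =>
    obtain ⟨φ, h, h'⟩ := ih (cons (Fin.last N) fun k => (g k).castSucc)
    refine ⟨_, .ex h, fun M _ v xs => ?_⟩
    simp [h', cons]

/-- A `Δ₀`-predicate can be added as a conjunct under the existential quantifiers. -/
theorem S1.and_left {P : ∀ (M : Type) [setLang.Structure M], (ℕ → M) → Prop} (h : S1 P) :
    ∀ {Q : ∀ (M : Type) [setLang.Structure M], (ℕ → M) → Prop} [D0 Q], S1 (fun M _ e => Q M e ∧ P M e) := by
  induction h with
  | d0 =>
    intro Q _
    exact .d0
  | @ex P _ ih =>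
    intro Q hQ
    have : D0 (fun M _ e => Q M fun n => e (n + 1)) := by
      exact hQ.comp _
    simpa using S1.ex (P := fun M _ e x => Q M e ∧ P M e x) ih

/-! ## Elementary set theory in a model of ZFC -/

section Basic

variable {M : Type} [setLang.Structure M]

/-- `z = {x, y}`, with bounded quantifiers. -/
def BUP (z x y : M) : Prop := x ε z ∧ y ε z ∧ ∀ w, w ε z → w = x ∨ w = y

/-- `p = ⟨x, y⟩`, with bounded quantifiers. -/
def OP (p x y : M) : Prop :=
  (∃ z, z ε p ∧ BUP z x x) ∧ (∃ z, z ε p ∧ BUP z x y) ∧ ∀ z, z ε p → BUP z x x ∨ BUP z x y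

/-- `⟨x, y⟩ ∈ f` -/
def PM (x y f : M) : Prop := ∃ p, p ε f ∧ OP p x y

/-- `a` is transitive. -/
def Trans (a : M) : Prop := ∀ x, x ε a → Sub x a

/-- `a` is an ordinal. -/
def Ord (a : M) : Prop := Trans a ∧ ∀ x, x ε a → Trans x

section Instances

variable {s t r : (ℕ → M) → M} [Tm s] [Tm t] [Tm r]

instance (priority := low) Tm.shift : Tm (fun e : ℕ → M => s fun n => e (n + 1)) := by
  obtain ⟨g, hg⟩ := ‹Tm s›.out
  rcases g with c | k
  · exact ⟨Sum.inl c, fun e => hg _⟩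
  · exact ⟨Sum.inr (k + 1), fun e => hg _⟩

instance Sub.df : Df (fun e => Sub (s e) (t e)) := by unfold Sub; infer_instance

instance BUP.df : Df (fun e => BUP (s e) (t e) (r e)) := by unfold BUP; infer_instance

instance OP.df : Df (fun e => OP (s e) (t e) (r e)) := by unfold OP; infer_instance

instance PM.df : Df (fun e => PM (s e) (t e) (r e)) := by unfold PM; infer_instance

instance Sub.d0 (i j : ℕ) : D0 (fun _ _ e => Sub (e i) (e j)) := by unfold Sub; infer_instance

instance BUP.d0 (i j k : ℕ) : D0 (fun _ _ e => BUP (e i) (e j) (e k)) := by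
  unfold BUP; infer_instance

instance OP.d0 (i j k : ℕ) : D0 (fun _ _ e => OP (e i) (e j) (e k)) := by
  unfold OP; infer_instance

instance PM.d0 (i j k : ℕ) : D0 (fun _ _ e => PM (e i) (e j) (e k)) := by
  unfold PM; infer_instance

end Instances

theorem Sub.refl (a : M) : Sub a a := fun _ h => h

theorem Sub.trans {a b c : M} (h : Sub a b) (h' : Sub b c) : Sub a c := fun x hx => h' x (h x hx)

theorem bup_iff {z x y : M} : BUP z x y ↔ IsUP z x y := by
  constructor
  · rintro ⟨h1, h2, h3⟩ w
    exact ⟨h3 w, by rintro (rfl | rfl) <;> assumption⟩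
  · intro h
    exact ⟨(h x).2 (.inl rfl), (h y).2 (.inr rfl), fun w hw => (h w).1 hw⟩

variable [ZFCM M]

theorem BUP.unique {z z' x y : M} (h : BUP z x y) (h' : BUP z' x y) : z = z' :=
  ext fun w => (bup_iff.1 h w).trans (bup_iff.1 h' w).symm

theorem exists_bup (x y : M) : ∃ z, BUP z x y :=
  (exists_pair x y).imp fun _ h => bup_iff.2 h

theorem op_iff {p x y : M} : OP p x y ↔ IsOP p x y := by
  constructor
  · rintro ⟨⟨a, ha, ha'⟩, ⟨b, hb, hb'⟩, h⟩ z
    rw [← bup_iff, ← bup_iff]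
    refine ⟨h z, ?_⟩
    rintro (hz | hz)
    · exact hz.unique ha' ▸ ha
    · exact hz.unique hb' ▸ hb
  · intro h
    simp only [IsOP, ← bup_iff] at h
    obtain ⟨a, ha⟩ := exists_bup x x
    obtain ⟨b, hb⟩ := exists_bup x y
    exact ⟨⟨a, (h a).2 (.inl ha), ha⟩, ⟨b, (h b).2 (.inr hb), hb⟩, fun z => (h z).1⟩

theorem exists_op (x y : M) : ∃ p, OP p x y := by
  obtain ⟨a, ha⟩ := exists_bup x x
  obtain ⟨b, hb⟩ := exists_bup x y
  obtain ⟨p, hp⟩ := exists_bup a b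
  refine ⟨p, ⟨a, hp.1, ha⟩, ⟨b, hp.2.1, hb⟩, fun z hz => ?_⟩
  rcases hp.2.2 z hz with rfl | rfl
  · exact .inl ha
  · exact .inr hb

theorem OP.unique {p q x y : M} (h : OP p x y) (h' : OP q x y) : p = q :=
  ext fun z => (op_iff.1 h z).trans (op_iff.1 h' z).symm

omit [ZFCM M] in
theorem OP.left {p x y x' y' : M} (h : OP p x y) (h' : OP p x' y') : x = x' := by
  obtain ⟨⟨a, ha, ha'⟩, -⟩ := h
  rcases h'.2.2 a ha with h | h
  · exact ((ha'.2.2 x' h.1).elim id id).symm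
  · exact ((ha'.2.2 x' h.1).elim id id).symm

omit [ZFCM M] in
theorem OP.right {p x y x' y' : M} (h : OP p x y) (h' : OP p x' y') : y = y' := by
  obtain rfl := h.left h'
  have key : ∀ {y y'}, OP p x y → OP p x y' → y = x ∨ y = y' := by
    intro y y' h h'
    obtain ⟨-, ⟨b, hb, hb'⟩, -⟩ := h
    rcases h'.2.2 b hb with h | h
    · exact .inl ((h.2.2 y hb'.2.1).elim id id)
    · exact h.2.2 y hb'.2.1
  rcases key h h' with rfl | h1
  · rcases key h' h with h2 | h2 <;> exact h2.symm
  · exact h1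

theorem OP.pm {p x y f : M} (h : OP p x y) : PM x y f ↔ p ε f := by
  refine ⟨fun ⟨q, hq, hq'⟩ => h.unique hq' ▸ hq, fun hp => ⟨p, hp, h⟩⟩

@[simp] theorem realize_isOPair {n : ℕ} (v : Empty → M) (xs : Fin n → M) (p x y : Fin n) :
    (isOPair p x y).Realize v xs ↔ OP (xs p) (xs x) (xs y) := by
  rw [op_iff]
  simp [isOPair, IsOP]

@[simp] theorem realize_pairMem {n : ℕ} (v : Empty → M) (xs : Fin n → M) (x y f : Fin n) :
    (pairMem x y f).Realize v xs ↔ PM (xs x) (xs y) (xs f) := by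
  simp [pairMem, PM, and_comm]

/-! ### Consequences of foundation, products, functions and choice -/

theorem mem_irrefl (x : M) : ¬ x ε x := by
  intro h
  obtain ⟨p, hp⟩ := exists_bup x x
  obtain ⟨y, hy, hy'⟩ := exists_minimal p ⟨x, hp.1⟩
  obtain rfl : y = x := (hp.2.2 y hy).elim id id
  exact hy' y h hp.1

theorem mem_asymm {x y : M} (h : x ε y) : ¬ y ε x := by
  intro h'
  obtain ⟨p, hp⟩ := exists_bup x y
  obtain ⟨z, hz, hz'⟩ := exists_minimal p ⟨x, hp.1⟩
  rcases hp.2.2 z hz with rfl | rfl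
  · exact hz' y h' hp.2.1
  · exact hz' x h hp.1

/-- Induction along membership inside a set. -/
theorem mem_induction (Q : M → Prop) [Df (fun e => Q (e 0))] (a : M)
    (h : ∀ x, x ε a → (∀ y, y ε x → y ε a → Q y) → Q x) : ∀ x, x ε a → Q x := by
  obtain ⟨b, hb⟩ := sep (fun x => ¬ Q x) a
  by_contra! ⟨x, hx, hx'⟩
  obtain ⟨y, hy, hy'⟩ := exists_minimal b ⟨x, (hb x).2 ⟨hx, hx'⟩⟩
  obtain ⟨hy1, hy2⟩ := (hb y).1 hy
  refine hy2 (h y hy1 fun z hz hza => ?_)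
  by_contra hQ
  exact hy' z hz ((hb z).2 ⟨hza, hQ⟩)

theorem exists_empty [Nonempty M] : ∃ x : M, ∀ y, ¬ y ε x := by
  obtain ⟨b, hb⟩ := sep (fun _ => False) (Classical.arbitrary M)
  exact ⟨b, fun y hy => ((hb y).1 hy).2⟩

theorem exists_union₂ (a b : M) : ∃ c, ∀ z, z ε c ↔ z ε a ∨ z ε b := by
  obtain ⟨p, hp⟩ := exists_pair a b
  obtain ⟨c, hc⟩ := exists_union p
  refine ⟨c, fun z => (hc z).trans ?_⟩
  simp [hp _]

theorem exists_insert (a x : M) : ∃ c, ∀ z, z ε c ↔ z ε a ∨ z = x := by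
  obtain ⟨p, hp⟩ := exists_pair x x
  obtain ⟨c, hc⟩ := exists_union₂ a p
  refine ⟨c, fun z => (hc z).trans ?_⟩
  simp [hp z]

theorem exists_prod (a b : M) : ∃ c, ∀ p, p ε c ↔ ∃ x y, x ε a ∧ y ε b ∧ OP p x y := by
  obtain ⟨u, hu⟩ := exists_union₂ a b
  obtain ⟨v, hv⟩ := exists_powerset u
  obtain ⟨w, hw⟩ := exists_powerset v
  obtain ⟨c, hc⟩ := sep (fun p => ∃ x y, x ε a ∧ y ε b ∧ OP p x y) w
  refine ⟨c, fun p => (hc p).trans (and_iff_right_of_imp ?_)⟩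
  rintro ⟨x, y, hx, hy, hp⟩
  refine (hw p).2 fun z hz => (hv z).2 fun t ht => (hu t).2 ?_
  rcases hp.2.2 z hz with h | h <;> rcases h.2.2 t ht with rfl | rfl <;> simp [*]

/-- A definable relation between the elements of two sets is a set. -/
theorem exists_rel (Q : M → M → Prop) [Df (fun e => Q (e 1) (e 0))] (a b : M) :
    ∃ r, (∀ x y, PM x y r ↔ x ε a ∧ y ε b ∧ Q x y) ∧ ∀ p, p ε r → ∃ x y, OP p x y := by
  obtain ⟨c, hc⟩ := exists_prod a b
  obtain ⟨r, hr⟩ := sep (fun p => ∃ x y, OP p x y ∧ Q x y) c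
  refine ⟨r, fun x y => ?_, fun p hp => ?_⟩
  · constructor
    · rintro ⟨p, hp, hp'⟩
      obtain ⟨hpc, x', y', h, hQ⟩ := (hr p).1 hp
      obtain ⟨x₁, y₁, hx, hy, h₁⟩ := (hc p).1 hpc
      obtain rfl := hp'.left h
      obtain rfl := hp'.right h
      obtain rfl := hp'.left h₁
      obtain rfl := hp'.right h₁
      exact ⟨hx, hy, hQ⟩
    · rintro ⟨hx, hy, hQ⟩
      obtain ⟨p, hp⟩ := exists_op x y
      exact ⟨p, (hr p).2 ⟨(hc p).2 ⟨x, y, hx, hy, hp⟩, x, y, hp, hQ⟩, hp⟩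
  · obtain ⟨-, x', y', h, -⟩ := (hr p).1 hp
    exact ⟨x', y', h⟩

/-- The second components of the pairs in `r` form a set. -/
theorem exists_range (r : M) : ∃ D, ∀ y, y ε D ↔ ∃ x, PM x y r := by
  obtain ⟨u, hu⟩ := exists_union r
  obtain ⟨v, hv⟩ := exists_union u
  obtain ⟨D, hD⟩ := sep (fun y => ∃ x, PM x y r) v
  refine ⟨D, fun y => (hD y).trans (and_iff_right_of_imp ?_)⟩
  rintro ⟨x, p, hp, h⟩
  obtain ⟨-, ⟨b, hb, hb'⟩, -⟩ := h
  exact (hv y).2 ⟨b, (hu b).2 ⟨p, hp, hb⟩, hb'.2.1⟩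

/-- `f` is a function with domain `d`. -/
def Fun (f d : M) : Prop := (∀ p, p ε f → ∃ x, x ε d ∧ ∃ y, OP p x y) ∧
  ∀ x, x ε d → ∃ y, PM x y f ∧ ∀ z, PM x z f → z = y

@[simp] theorem realize_isFun {n : ℕ} (v : Empty → M) (xs : Fin n → M) (f d : Fin n) :
    (isFun f d).Realize v xs ↔ Fun (xs f) (xs d) := by
  simp [isFun, Fun]

omit [ZFCM M] in
theorem Fun.unique {f d x y z : M} (h : Fun f d) (hx : x ε d) (hy : PM x y f) (hz : PM x z f) :
    y = z := by
  obtain ⟨t, -, ht⟩ := h.2 x hx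
  rw [ht y hy, ht z hz]

theorem exists_choiceFun (x : M) (h : ∀ y, y ε x → ∃ z, z ε y) :
    ∃ f, Fun f x ∧ ∀ y, y ε x → ∃ z, z ε y ∧ PM y z f := by
  have := realize_axiom (M := M) ZFC.choice
  simp [choice, Sentence.Realize, Formula.Realize] at this
  simpa [Fin.snoc] using this x (by simpa [Fin.snoc] using h)

/-- The axiom of choice for definable relations between the elements of two sets. -/
theorem exists_choose (Q : M → M → Prop) [Df (fun e => Q (e 1) (e 0))] (a b : M)
    (h : ∀ x, x ε a → ∃ y, y ε b ∧ Q x y) :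
    ∃ F, ∀ x, x ε a → ∃ y, y ε b ∧ Q x y ∧ PM x y F ∧ ∀ z, PM x z F → z = y := by
  have := Df.subst₂ Q
  obtain ⟨c, hc⟩ := exists_prod a b
  obtain ⟨d, hd⟩ := exists_powerset c
  -- The fibre over `x` consists of pairs `⟨x, y⟩`, so that an element chosen from a fibre
  -- determines `x`.
  obtain ⟨S, hS⟩ := sep (fun Y => ∃ x, x ε a ∧ ∀ p, p ε Y ↔ ∃ y, y ε b ∧ OP p x y ∧ Q x y) d
  obtain ⟨f, hf, hf'⟩ := exists_choiceFun S fun Y hY => by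
    obtain ⟨-, x, hx, hY⟩ := (hS Y).1 hY
    obtain ⟨y, hy, hQ⟩ := h x hx
    obtain ⟨p, hp⟩ := exists_op x y
    exact ⟨p, (hY p).2 ⟨y, hy, hp, hQ⟩⟩
  obtain ⟨F, hF, -⟩ := exists_rel (fun x y => ∃ Y p, Y ε S ∧ OP p x y ∧ PM Y p f ∧ p ε Y) a b
  refine ⟨F, fun x hx => ?_⟩
  obtain ⟨Y, hYc⟩ := sep (fun p => ∃ y, y ε b ∧ OP p x y ∧ Q x y) c
  have hY : ∀ p, p ε Y ↔ ∃ y, y ε b ∧ OP p x y ∧ Q x y := fun p =>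
    (hYc p).trans (and_iff_right_of_imp fun ⟨y, hy, hp, _⟩ => (hc p).2 ⟨x, y, hx, hy, hp⟩)
  have hYS : Y ε S := (hS Y).2 ⟨(hd Y).2 fun p hp => ((hYc p).1 hp).1, x, hx, hY⟩
  obtain ⟨p, hpY, hp⟩ := hf' Y hYS
  obtain ⟨y, hy, hpy, hQ⟩ := (hY p).1 hpY
  refine ⟨y, hy, hQ, (hF x y).2 ⟨hx, hy, Y, p, hYS, hpy, hp, hpY⟩, fun z hz => ?_⟩
  obtain ⟨-, -, Y', p', hYS', hpz, hp', hpY'⟩ := (hF x z).1 hz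
  obtain ⟨-, x', -, hY'⟩ := (hS Y').1 hYS'
  obtain ⟨y', -, hpy', -⟩ := (hY' p').1 hpY'
  obtain rfl := hpz.left hpy'
  obtain rfl : Y = Y' := ext fun q => (hY q).trans (hY' q).symm
  obtain rfl := hf.unique hYS hp hp'
  exact hpz.right hpy

/-! ## Ordinals -/

/-- Induction is available inside a set only. Hence all elements of `a ∪ {a}` are compared with all
elements of `b ∪ {b}`, by a double `∈`-induction. -/
theorem Ord.trichotomy {a b : M} (ha : Ord a) (hb : Ord b) : a ε b ∨ a = b ∨ b ε a := by
  obtain ⟨a', ha'⟩ := exists_insert a a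
  obtain ⟨b', hb'⟩ := exists_insert b b
  have hat : ∀ x, x ε a' → ∀ y, y ε x → y ε a' := by
    intro x hx y hy
    rcases (ha' x).1 hx with h | rfl
    · exact (ha' y).2 (.inl (ha.1 x h y hy))
    · exact (ha' y).2 (.inl hy)
  have hbt : ∀ x, x ε b' → ∀ y, y ε x → y ε b' := by
    intro x hx y hy
    rcases (hb' x).1 hx with h | rfl
    · exact (hb' y).2 (.inl (hb.1 x h y hy))
    · exact (hb' y).2 (.inl hy)
  have hat' : ∀ x, x ε a' → Trans x := by
    intro x hx
    rcases (ha' x).1 hx with h | rfl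
    · exact ha.2 x h
    · exact ha.1
  have hbt' : ∀ x, x ε b' → Trans x := by
    intro x hx
    rcases (hb' x).1 hx with h | rfl
    · exact hb.2 x h
    · exact hb.1
  have key : ∀ x, x ε a' → ∀ y, y ε b' → x ε y ∨ x = y ∨ y ε x := by
    refine mem_induction (fun x => ∀ y, y ε b' → x ε y ∨ x = y ∨ y ε x) a' fun x hx ih => ?_
    refine mem_induction (fun y => x ε y ∨ x = y ∨ y ε x) b' fun y hy ih' => ?_
    by_contra! hne
    obtain ⟨h1, h2, h3⟩ := hne
    refine h2 (ext fun z => ⟨fun hz => ?_, fun hz => ?_⟩)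
    · rcases ih z hz (hat x hx z hz) y hy with h | rfl | h
      · exact h
      · exact (h3 hz).elim
      · exact (h3 (hat' x hx z hz y h)).elim
    · rcases ih' z hz (hbt y hy z hz) with h | rfl | h
      · exact (h1 (hbt' y hy z hz x h)).elim
      · exact (h1 hz).elim
      · exact h
  exact key a ((ha' a).2 (.inr rfl)) b ((hb' b).2 (.inr rfl))

end Basic
/-! ## Systems of levels -/

section Levels

variable {M : Type} [setLang.Structure M]

/-- `V` is transitive and closed under subsets. -/
def Nice (V : M) : Prop := Trans V ∧ ∀ x, x ε V → ∀ y, Sub y x → y ε V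

/-- `C` is a chain of elements of `V` that covers `V`, such that every level contains all the subsets
of some earlier one, and `U` is a function from the element `W` of `V` onto `C`. -/
def Sys (V C W U : M) : Prop :=
  (∀ u, u ε C → u ε V) ∧
  (∀ x, x ε V → ∃ u, u ε C ∧ x ε u ∧ Sub x u) ∧
  (∀ u, u ε C → ∀ v, v ε C → Sub u v ∨ Sub v u) ∧
  (∀ u, u ε C → ∃ v, v ε C ∧ Sub u v ∧ ∀ y, y ε V → Sub y u → y ε v) ∧
  W ε V ∧
  (∀ k, k ε W → ∃ v, v ε C ∧ PM k v U) ∧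
  (∀ k, k ε W → ∀ v, v ε C → ∀ v', v' ε C → PM k v U → PM k v' U → v = v') ∧
  (∀ v, v ε C → ∃ k, k ε W ∧ PM k v U)

instance Sys.d0 (v c w q : ℕ) : D0 (fun _ _ e => Sys (e v) (e c) (e w) (e q)) := by
  unfold Sys; infer_instance

variable {V C W U : M}

namespace Sys

theorem mem (h : Sys V C W U) {u : M} (hu : u ε C) : u ε V := h.1 u hu

theorem cover (h : Sys V C W U) {x : M} (hx : x ε V) : ∃ u, u ε C ∧ x ε u ∧ Sub x u := h.2.1 x hx

theorem linear (h : Sys V C W U) {u v : M} (hu : u ε C) (hv : v ε C) : Sub u v ∨ Sub v u :=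
  h.2.2.1 u hu v hv

theorem pow (h : Sys V C W U) {u : M} (hu : u ε C) :
    ∃ v, v ε C ∧ Sub u v ∧ ∀ y, y ε V → Sub y u → y ε v := h.2.2.2.1 u hu

theorem index_mem (h : Sys V C W U) : W ε V := h.2.2.2.2.1

theorem level_exists (h : Sys V C W U) {k : M} (hk : k ε W) : ∃ v, v ε C ∧ PM k v U :=
  h.2.2.2.2.2.1 k hk

theorem level_unique (h : Sys V C W U) {k v v' : M} (hk : k ε W) (hv : v ε C) (hv' : v' ε C)
    (hp : PM k v U) (hp' : PM k v' U) : v = v' :=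
  h.2.2.2.2.2.2.1 k hk v hv v' hv' hp hp'

theorem index_exists (h : Sys V C W U) {v : M} (hv : v ε C) : ∃ k, k ε W ∧ PM k v U :=
  h.2.2.2.2.2.2.2 v hv

theorem sub (h : Sys V C W U) (hV : Nice V) {u : M} (hu : u ε C) : Sub u V := hV.1 u (h.mem hu)

theorem upper (h : Sys V C W U) {u v : M} (hu : u ε C) (hv : v ε C) :
    ∃ w, w ε C ∧ Sub u w ∧ Sub v w := by
  rcases h.linear hu hv with h | h
  · exact ⟨v, hv, h, Sub.refl v⟩
  · exact ⟨u, hu, Sub.refl u, h⟩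

theorem pair_mem (h : Sys V C W U) (hV : Nice V) {x y z : M} (hx : x ε V) (hy : y ε V)
    (hz : BUP z x y) : z ε V := by
  obtain ⟨u, hu, hxu, -⟩ := h.cover hx
  obtain ⟨v, hv, hyv, -⟩ := h.cover hy
  obtain ⟨w, hw, huw, hvw⟩ := h.upper hu hv
  refine hV.2 w (h.mem hw) z fun t ht => ?_
  rcases hz.2.2 t ht with rfl | rfl
  · exact huw _ hxu
  · exact hvw _ hyv

theorem op_mem [ZFCM M] (h : Sys V C W U) (hV : Nice V) {x y p : M} (hx : x ε V) (hy : y ε V)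
    (hp : OP p x y) : p ε V := by
  obtain ⟨a, ha⟩ := exists_bup x x
  obtain ⟨b, hb⟩ := exists_bup x y
  refine h.pair_mem hV (h.pair_mem hV hx hx ha) (h.pair_mem hV hx hy hb) (x := a) (y := b) ?_
  obtain ⟨⟨a', ha'p, ha'⟩, ⟨b', hb'p, hb'⟩, h3⟩ := hp
  obtain rfl := ha.unique ha'
  obtain rfl := hb.unique hb'
  exact ⟨ha'p, hb'p, fun w hw => (h3 w hw).imp (fun h => h.unique ha) fun h => h.unique hb⟩

/-- Some level contains `x` and the pairs `⟨x, t⟩` for `t ∈ v`. -/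
theorem prod (h : Sys V C W U) [ZFCM M] (hV : Nice V) {x v : M} (hx : x ε V) (hv : v ε C) :
    ∃ u, u ε C ∧ x ε u ∧ Sub v u ∧ ∀ t, t ε v → ∃ p, p ε u ∧ OP p x t := by
  obtain ⟨u, hu, hxu, -⟩ := h.cover hx
  -- Unordered pairs from `u₁` that contain `x` appear in `u₂`, so the ordered pairs appear in `u₃`.
  obtain ⟨u₁, hu₁, huu₁, hvu₁⟩ := h.upper hu hv
  obtain ⟨u₂, hu₂, h12, hp₂⟩ := h.pow hu₁
  obtain ⟨u₃, hu₃, h23, hp₃⟩ := h.pow hu₂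
  refine ⟨u₃, hu₃, h23 _ (h12 _ (huu₁ _ hxu)), (hvu₁.trans h12).trans h23, fun t ht => ?_⟩
  have htV : t ε V := h.sub hV hv t ht
  obtain ⟨p, hp⟩ := exists_op x t
  have key : ∀ z y, y ε u₁ → BUP z x y → z ε u₂ := fun z y hy hz => by
    refine hp₂ z (h.pair_mem hV hx (h.sub hV hu₁ _ hy) hz) fun s hs => ?_
    rcases hz.2.2 s hs with rfl | rfl
    · exact huu₁ _ hxu
    · exact hy
  refine ⟨p, hp₃ p (h.op_mem hV hx htV hp) fun z hz => ?_, hp⟩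
  rcases hp.2.2 z hz with hz | hz
  · exact key z x (huu₁ _ hxu) hz
  · exact key z t (hvu₁ _ ht) hz

theorem exists_empty_mem (h : Sys V C W U) [ZFCM M] (hV : Nice V) : ∃ x, x ε V ∧ ∀ y, ¬ y ε x := by
  have : Nonempty M := ⟨V⟩
  obtain ⟨x, hx⟩ := exists_empty (M := M)
  exact ⟨x, hV.2 W h.index_mem x fun y hy => (hx y hy).elim, hx⟩

theorem exists_nonempty_mem (h : Sys V C W U) [ZFCM M] (hV : Nice V) :
    ∃ x, x ε V ∧ ∃ y, y ε x := by
  obtain ⟨x, hx⟩ := exists_bup W W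
  exact ⟨x, h.pair_mem hV h.index_mem h.index_mem hx, W, hx.1⟩

theorem exists_level (h : Sys V C W U) : ∃ u, u ε C :=
  (h.cover h.index_mem).imp fun _ h => h.1

end Sys

/-- The section of `Z` at `x`, inside `v`. -/
def Sec (z Z x v : M) : Prop :=
  (∀ t, t ε z → t ε v) ∧ ∀ t, t ε v → (t ε z ↔ PM x t Z)

instance Sec.d0 (i j k l : ℕ) : D0 (fun _ _ e => Sec (e i) (e j) (e k) (e l)) := by
  unfold Sec; infer_instance

theorem exists_sec [ZFCM M] (Z x v : M) : ∃ z, Sec z Z x v := by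
  obtain ⟨z, hz⟩ := sep (fun t => PM x t Z) v
  exact ⟨z, fun t ht => ((hz t).1 ht).1, fun t ht => (hz t).trans (and_iff_right ht)⟩

/-- `v` is a subset of `u` and `u` contains the pairs `⟨x, t⟩` for `t ∈ v`. -/
def Pairs (x v u : M) : Prop := Sub v u ∧ ∀ t, t ε v → ∃ p, p ε u ∧ OP p x t

instance Pairs.d0 (i j k : ℕ) : D0 (fun _ _ e => Pairs (e i) (e j) (e k)) := by
  unfold Pairs; infer_instance

/-- Membership of `t` in the section is decided by the pair `⟨x, t⟩`, which lies in `u`. Conditions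
on sections are therefore local at `u`. -/
theorem Sec.local [ZFCM M] {z Z Z' x v u : M} (h : Sec z Z x v) (hp : Pairs x v u)
    (hZ : ∀ p, p ε u → (p ε Z ↔ p ε Z')) : Sec z Z' x v := by
  refine ⟨h.1, fun t ht => (h.2 t ht).trans ?_⟩
  obtain ⟨p, hpu, hp⟩ := hp.2 t ht
  rw [hp.pm, hp.pm, hZ p hpu]

end Levels

/-! ## Predicates with closed representations -/

/-- Predicates of `V`, of `m` subsets of `V`, and of `n` elements of `V`. -/
abbrev Pred (m n : ℕ) : Type 1 := ∀ (M : Type) [setLang.Structure M],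
  M → (Fin m → M) → (Fin n → M) → Prop

/-- Agreement inside `u`. -/
def Agree {M : Type} [setLang.Structure M] (u a b : M) : Prop := ∀ x, x ε u → (x ε a ↔ x ε b)

theorem Agree.refl {M : Type} [setLang.Structure M] (u a : M) : Agree u a a := fun _ _ => Iff.rfl

theorem Agree.mono {M : Type} [setLang.Structure M] {u v a b : M} (h : Agree u a b) (hv : Sub v u) :
    Agree v a b := fun x hx => h x (hv x hx)

/-- The truth of `R(F, G, z, u)` depends only on the parts of `F` and `z` inside `u`. -/
def Loc {m n : ℕ} (R : Rel m n) : Prop :=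
  ∀ (M : Type) [setLang.Structure M] [ZFCM M] (V C W U : M) (F F' : Fin m → M) (G : Fin n → M)
    (z z' u : M),
    (∀ j, Agree u (F j) (F' j)) → Agree u z z' → R M V C W U F G z u → R M V C W U F' G z' u

/-- `R` represents `P`: for every system of levels, `P` holds if and only if some subset `Z` of `V`
satisfies `R` at all levels. -/
def Represents {m n : ℕ} (R : Rel m n) (P : Pred m n) : Prop :=
  ∀ (M : Type) [setLang.Structure M] [ZFCM M] (V C W U : M), Nice V → Sys V C W U →
    ∀ (F : Fin m → M) (G : Fin n → M), (∀ j, Sub (F j) V) → (∀ j, G j ε V) →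
      (P M V F G ↔ ∃ Z, Sub Z V ∧ ∀ u, u ε C → R M V C W U F G Z u)

/-- `P` is represented by a local `Δ₀`-predicate. -/
def Rep {m n : ℕ} (P : Pred m n) : Prop := ∃ R : Rel m n, D0R R ∧ Loc R ∧ Represents R P

namespace Rep

variable {m n : ℕ}

theorem congr {P Q : Pred m n} (h : Rep P)
    (hPQ : ∀ (M : Type) [setLang.Structure M] [ZFCM M] (V C W U : M), Nice V → Sys V C W U →
      ∀ (F : Fin m → M) (G : Fin n → M), (∀ j, Sub (F j) V) → (∀ j, G j ε V) →
        (Q M V F G ↔ P M V F G)) : Rep Q := by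
  obtain ⟨R, h1, h2, h3⟩ := h
  exact ⟨R, h1, h2, fun M _ _ V C W U hV hS F G hF hG =>
    (hPQ M V C W U hV hS F G hF hG).trans (h3 M V C W U hV hS F G hF hG)⟩

/-- A predicate that holds if and only if a local predicate holds at all levels. -/
theorem of_levels {P : Pred m n} {R : Rel m n} (h : D0R R) (hR : Loc R)
    (hP : ∀ (M : Type) [setLang.Structure M] [ZFCM M] (V C W U : M), Nice V → Sys V C W U →
      ∀ (F : Fin m → M) (G : Fin n → M), (∀ j, Sub (F j) V) → (∀ j, G j ε V) →
        ∀ Z, (P M V F G ↔ ∀ u, u ε C → R M V C W U F G Z u)) : Rep P :=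
  ⟨R, h, hR, fun M _ _ V C W U hV hS F G hF hG =>
    ⟨fun h => ⟨V, Sub.refl V, (hP M V C W U hV hS F G hF hG V).1 h⟩,
      fun ⟨Z, _, h⟩ => (hP M V C W U hV hS F G hF hG Z).2 h⟩⟩

/-- A `Δ₀`-predicate of the first-order variables only. -/
theorem of_elements {P : Pred m n}
    (h : ∀ (v : ℕ) (F : Fin m → ℕ) (G : Fin n → ℕ),
      D0 (fun M _ e => P M (e v) (fun j => e (F j)) (fun j => e (G j))))
    (hP : ∀ (M : Type) [setLang.Structure M] (V : M) (F F' : Fin m → M) (G : Fin n → M),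
      P M V F G → P M V F' G) : Rep P :=
  of_levels (R := fun M _ V _ _ _ F G _ _ => P M V F G)
    ⟨fun v _ _ _ F G _ _ => h v F G⟩
    (fun M _ _ V _ _ _ F F' G _ _ _ _ _ h => hP M V F F' G h)
    fun _ _ _ _ _ _ _ _ hS _ _ _ _ _ => ⟨fun h _ _ => h, fun h =>
      let ⟨u, hu⟩ := hS.exists_level
      h u hu⟩

/-- The guard `G x ε u` makes the condition local at `u`, and some level satisfies the guard because
the levels cover `V`. -/
theorem memSet (x : Fin n) (X : Fin m) : Rep (fun _ _ _ F G => G x ε F X : Pred m n) :=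
  of_levels (R := fun _ _ _ _ _ _ F G _ u => G x ε u → G x ε F X)
    ⟨fun v c w q F G z u => by infer_instance⟩
    (fun _ _ _ _ _ _ _ _ _ _ _ _ _ hF _ h hu => (hF X _ hu).1 (h hu))
    fun _ _ _ _ _ _ _ _ hS _ G _ hG _ => ⟨fun h _ _ _ => h, fun h =>
      let ⟨u, hu, hx, _⟩ := hS.cover (hG x)
      h u hu hx⟩

theorem not_memSet (x : Fin n) (X : Fin m) : Rep (fun _ _ _ F G => ¬ G x ε F X : Pred m n) :=
  of_levels (R := fun _ _ _ _ _ _ F G _ u => G x ε u → ¬ G x ε F X)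
    ⟨fun v c w q F G z u => by infer_instance⟩
    (fun _ _ _ _ _ _ _ _ _ _ _ _ _ hF _ h hu h' => h hu ((hF X _ hu).2 h'))
    fun _ _ _ _ _ _ _ _ hS _ G _ hG _ => ⟨fun h _ _ _ => h, fun h =>
      let ⟨u, hu, hx, _⟩ := hS.cover (hG x)
      h u hu hx⟩

theorem init {P : Pred m n} (h : Rep P) :
    Rep (fun M _ V F G => P M V F (Fin.init (α := fun _ => M) G) : Pred m (n + 1)) := by
  obtain ⟨R, h1, h2, h3⟩ := h
  refine ⟨fun M _ V C W U F G z u => R M V C W U F (Fin.init (α := fun _ => M) G) z u,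
    ⟨fun v c w q F G z u => by infer_instance⟩,
    fun M _ _ V C W U F F' G z z' u hF hz => h2 M V C W U F F' _ z z' u hF hz,
    fun M _ _ V C W U hV hS F G hF hG => h3 M V C W U hV hS F _ hF fun j => hG _⟩

/-- Conditional on the last set containing the last element. -/
theorem mem_imp {P : Pred m (n + 1)} (h : Rep P) :
    Rep (fun M _ V F G => G (Fin.last n) ε F (Fin.last m) →
      P M V (Fin.init (α := fun _ => M) F) G : Pred (m + 1) (n + 1)) := by
  obtain ⟨R, h1, h2, h3⟩ := h
  -- The guard may fail at small levels; the condition there is imposed by a larger level, which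
  -- inspects all levels below it.
  refine ⟨fun M _ V C W U F G z u => G (Fin.last n) ε u → G (Fin.last n) ε F (Fin.last m) →
      ∀ v, v ε C → Sub v u → R M V C W U (Fin.init (α := fun _ => M) F) G z v,
    ⟨fun v c w q F G z u => by infer_instance⟩,
    fun M _ _ V C W U F F' G z z' u hF hz h hu hm v hv hvu =>
      h2 M V C W U _ _ G z z' v (fun j => (hF _).mono hvu) (hz.mono hvu)
        (h hu ((hF _ _ hu).2 hm) v hv hvu),
    fun M _ _ V C W U hV hS F G hF hG => ?_⟩
  have h3 := h3 M V C W U hV hS (Fin.init (α := fun _ => M) F) G (fun j => hF _) hG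
  constructor
  · intro h
    by_cases hm : G (Fin.last n) ε F (Fin.last m)
    · obtain ⟨Z, hZ, hR⟩ := h3.1 (h hm)
      exact ⟨Z, hZ, fun _ _ _ _ v hv _ => hR v hv⟩
    · exact ⟨V, Sub.refl V, fun _ _ _ hm' => (hm hm').elim⟩
  · rintro ⟨Z, hZ, hR⟩ hm
    refine h3.2 ⟨Z, hZ, fun v hv => ?_⟩
    obtain ⟨u, hu, hxu, -⟩ := hS.cover (hG (Fin.last n))
    obtain ⟨w, hw, huw, hvw⟩ := hS.upper hu hv
    exact hR w hw (huw _ hxu) hm v hv hvw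

/-- Distinction of cases according to whether the last element is empty. -/
theorem cases {P Q : Pred m n} (h : Rep P) (h' : Rep Q) :
    Rep (fun M _ V F G =>
      ((∀ y, y ε G (Fin.last n) → False) → P M V F (Fin.init (α := fun _ => M) G)) ∧
      (¬ (∀ y, y ε G (Fin.last n) → False) → Q M V F (Fin.init (α := fun _ => M) G)) :
        Pred m (n + 1)) := by
  obtain ⟨R, h1, h2, h3⟩ := h.init
  obtain ⟨R', h1', h2', h3'⟩ := h'.init
  refine ⟨fun M _ V C W U F G z u => ((∀ y, y ε G (Fin.last n) → False) → R M V C W U F G z u) ∧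
      (¬ (∀ y, y ε G (Fin.last n) → False) → R' M V C W U F G z u),
    ⟨fun v c w q F G z u => by infer_instance⟩,
    fun M _ _ V C W U F F' G z z' u hF hz h =>
      ⟨fun he => h2 M V C W U F F' G z z' u hF hz (h.1 he),
        fun he => h2' M V C W U F F' G z z' u hF hz (h.2 he)⟩,
    fun M _ _ V C W U hV hS F G hF hG => ?_⟩
  have h3 := h3 M V C W U hV hS F G hF hG
  have h3' := h3' M V C W U hV hS F G hF hG
  beta_reduce
  generalize (∀ y, y ε G (Fin.last n) → False) = A
  by_cases he : A
  · simpa only [he, not_true, false_imp_iff, true_imp_iff, and_true, imp_true_iff] using h3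
  · simpa only [he, not_false_iff, false_imp_iff, true_imp_iff, true_and, imp_true_iff] using h3'

/-- The last set is not empty. -/
theorem nonempty : Rep (fun _ _ _ F _ => ∃ x, x ε F (Fin.last m) : Pred (m + 1) n) := by
  -- `Z` names elements of `W` as indices of levels that meet the last set. Since `W ∈ V`, some
  -- level includes `W`, and the demand that an index be named is local there.
  refine ⟨fun M _ V C W U F G z u => Sub W u → (∃ k, k ε W ∧ k ε z) ∧
      ∀ k, k ε W → k ε z → ∀ v, v ε C → PM k v U → Sub v u → ∃ x, x ε v ∧ x ε F (Fin.last m),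
    ⟨fun v c w q F G z u => by infer_instance⟩,
    fun M _ _ V C W U F F' G z z' u hF hz h hW => ?_,
    fun M _ _ V C W U hV hS F G hF hG => ?_⟩
  · obtain ⟨⟨k, hk, hkz⟩, h⟩ := h hW
    refine ⟨⟨k, hk, (hz k (hW k hk)).1 hkz⟩, fun k hk hkz v hv hp hvu => ?_⟩
    obtain ⟨x, hx, hxF⟩ := h k hk ((hz k (hW k hk)).2 hkz) v hv hp hvu
    exact ⟨x, hx, (hF _ x (hvu x hx)).1 hxF⟩
  · constructor
    · rintro ⟨x, hx⟩
      obtain ⟨v, hv, hxv, -⟩ := hS.cover (hF _ x hx)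
      obtain ⟨k, hk, hp⟩ := hS.index_exists hv
      obtain ⟨Z, hZ⟩ := exists_bup k k
      refine ⟨Z, fun t ht => ?_, fun u hu hW => ⟨⟨k, hk, hZ.1⟩, fun k' hk' hkZ v' hv' hp' _ => ?_⟩⟩
      · obtain rfl := (hZ.2.2 t ht).elim id id
        exact hV.1 W hS.index_mem _ hk
      · obtain rfl := (hZ.2.2 k' hkZ).elim id id
        obtain rfl := hS.level_unique hk hv hv' hp hp'
        exact ⟨x, hxv, hx⟩
    · rintro ⟨Z, -, h⟩
      obtain ⟨u, hu, -, hW⟩ := hS.cover hS.index_mem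
      obtain ⟨⟨k, hk, hkZ⟩, -⟩ := h u hu hW
      obtain ⟨v, hv, hp⟩ := hS.level_exists hk
      obtain ⟨w, hw, huw, hvw⟩ := hS.upper hu hv
      obtain ⟨x, -, hx⟩ := (h w hw (hW.trans huw)).2 k hk hkZ v hv hp hvw
      exact ⟨x, hx⟩

/-- Quantification over the elements of `V`. -/
theorem all {P : Pred m (n + 1)} (h : Rep P) :
    Rep (fun M _ V F G => ∀ x, x ε V → P M V F (Fin.snoc (α := fun _ => M) G x) : Pred m n) := by
  obtain ⟨R, h1, h2, h3⟩ := h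
  -- `Z` codes the family of witnesses, its section at `x` being the witness for `x`. The condition
  -- at `u` tests only those sections that `u` can see.
  refine ⟨fun M _ V C W U F G Z u => ∀ x, x ε u → ∀ v, v ε C → Pairs x v u →
      ∃ z, z ε V ∧ Sec z Z x v ∧ R M V C W U F (Fin.snoc (α := fun _ => M) G x) z v,
    ⟨fun v c w q F G z u => by infer_instance⟩,
    fun M _ _ V C W U F F' G Z Z' u hF hZ h x hx v hv hp => ?_,
    fun M _ _ V C W U hV hS F G hF hG => ?_⟩
  · obtain ⟨z, hz, hs, hR⟩ := h x hx v hv hp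
    exact ⟨z, hz, hs.local hp hZ, h2 M V C W U F F' _ z z v (fun j => (hF j).mono hp.1)
      (fun _ _ => Iff.rfl) hR⟩
  have hG' : ∀ x, x ε V → ∀ j, Fin.snoc (α := fun _ => M) G x j ε V := fun x hx j =>
    Fin.lastCases (by simpa using hx) (fun j => by simpa using hG j) j
  constructor
  · intro h
    obtain ⟨B, hB⟩ := exists_powerset V
    obtain ⟨f, hf⟩ := exists_choose
      (fun x Y => ∀ u, u ε C → R M V C W U F (Fin.snoc (α := fun _ => M) G x) Y u) V B
      fun x hx => by
        obtain ⟨Z, hZ, hR⟩ := (h3 M V C W U hV hS F _ hF (hG' x hx)).1 (h x hx)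
        exact ⟨Z, (hB Z).2 hZ, hR⟩
    obtain ⟨Z, hZ, hZ'⟩ := exists_rel (fun x t => ∃ Y, PM x Y f ∧ t ε Y) V V
    refine ⟨Z, fun p hp => ?_, fun u hu x hx v hv hp => ?_⟩
    · obtain ⟨x, y, hxy⟩ := hZ' p hp
      obtain ⟨hx, hy, -⟩ := (hZ x y).1 ⟨p, hp, hxy⟩
      exact hS.op_mem hV hx hy hxy
    · have hxV := hS.sub hV hu x hx
      obtain ⟨z, hz⟩ := exists_sec Z x v
      refine ⟨z, hV.2 v (hS.mem hv) z hz.1, hz, ?_⟩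
      obtain ⟨Y, hY, hR, hxY, huniq⟩ := hf x hxV
      refine h2 M V C W U F F _ Y z v (fun _ _ _ => Iff.rfl) (fun t ht => ?_) (hR v hv)
      rw [hz.2 t ht, hZ]
      constructor
      · intro htY
        exact ⟨hxV, hS.sub hV hv t ht, Y, hxY, htY⟩
      · rintro ⟨-, -, Y', hY', htY'⟩
        rwa [huniq Y' hY'] at htY'
  · rintro ⟨Z, hZ, h⟩ x hx
    obtain ⟨z, hz⟩ := exists_sec Z x V
    refine (h3 M V C W U hV hS F _ hF (hG' x hx)).2 ⟨z, hz.1, fun v hv => ?_⟩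
    obtain ⟨u, hu, hxu, hvu, hp⟩ := hS.prod hV hx hv
    obtain ⟨z', -, hz', hR⟩ := h u hu x hxu v hv ⟨hvu, hp⟩
    refine h2 M V C W U F F _ z' z v (fun _ _ _ => Iff.rfl) (fun t ht => ?_) hR
    rw [hz'.2 t ht, hz.2 t (hS.sub hV hv t ht)]

/-- Quantification over the subsets of `V`. -/
theorem ex₂ {P : Pred (m + 1) n} (h : Rep P) :
    Rep (fun M _ V F G => ∃ Y, Sub Y V ∧ P M V (Fin.snoc (α := fun _ => M) F Y) G : Pred m n) := by
  obtain ⟨R, h1, h2, h3⟩ := h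
  -- One set codes two: its section at the empty set is `Y`, and its section at any nonempty element
  -- is the witness for `P`.
  refine ⟨fun M _ V C W U F G Z u => ∀ a, a ε u → ∀ b, b ε u → (∀ y, y ε a → False) →
      ¬ (∀ y, y ε b → False) → ∀ v, v ε C → Pairs a v u → Pairs b v u →
      ∃ y, y ε V ∧ Sec y Z a v ∧ ∃ z, z ε V ∧ Sec z Z b v ∧
        R M V C W U (Fin.snoc (α := fun _ => M) F y) G z v,
    ⟨fun v c w q F G z u => by infer_instance⟩,
    fun M _ _ V C W U F F' G Z Z' u hF hZ h a ha b hb ha' hb' v hv hpa hpb => ?_,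
    fun M _ _ V C W U hV hS F G hF hG => ?_⟩
  · obtain ⟨y, hy, hsy, z, hz, hsz, hR⟩ := h a ha b hb ha' hb' v hv hpa hpb
    refine ⟨y, hy, hsy.local hpa hZ, z, hz, hsz.local hpb hZ, h2 M V C W U _ _ G z z v (fun j => ?_)
      (fun _ _ => Iff.rfl) hR⟩
    refine Fin.lastCases ?_ (fun j => ?_) j
    · simpa using Agree.refl _ _
    · simpa using (hF j).mono hpa.1
  have hF' : ∀ Y, Sub Y V → ∀ j, Sub (Fin.snoc (α := fun _ => M) F Y j) V := fun x hx j =>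
    Fin.lastCases (by simpa using hx) (fun j => by simpa using hF j) j
  have hag : ∀ {v Y y : M}, Agree v Y y → ∀ j, Agree v (Fin.snoc (α := fun _ => M) F Y j)
      (Fin.snoc (α := fun _ => M) F y j) := fun h j =>
    Fin.lastCases (by simpa using h) (fun j => by simpa using Agree.refl _ _) j
  constructor
  · rintro ⟨Y, hY, hP⟩
    obtain ⟨X, hX, hR⟩ := (h3 M V C W U hV hS _ G (hF' Y hY) hG).1 hP
    obtain ⟨Z, hZ, hZ'⟩ := exists_rel (fun x t => ((∀ y, y ε x → False) → t ε Y) ∧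
      (¬ (∀ y, y ε x → False) → t ε X)) V V
    refine ⟨Z, fun p hp => ?_, fun u hu a ha b hb ha' hb' v hv hpa hpb => ?_⟩
    · obtain ⟨x, y, hxy⟩ := hZ' p hp
      obtain ⟨hx, hy, -⟩ := (hZ x y).1 ⟨p, hp, hxy⟩
      exact hS.op_mem hV hx hy hxy
    · obtain ⟨y, hy⟩ := exists_sec Z a v
      obtain ⟨z, hz⟩ := exists_sec Z b v
      refine ⟨y, hV.2 v (hS.mem hv) y hy.1, hy, z, hV.2 v (hS.mem hv) z hz.1, hz, ?_⟩
      refine h2 M V C W U _ _ G X z v (hag fun t ht => ?_) (fun t ht => ?_) (hR v hv)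
      · rw [hy.2 t ht, hZ]
        have := hS.sub hV hu a ha
        have := hS.sub hV hv t ht
        tauto
      · rw [hz.2 t ht, hZ]
        have := hS.sub hV hu b hb
        have := hS.sub hV hv t ht
        tauto
  · rintro ⟨Z, hZ, h⟩
    obtain ⟨a, ha, ha'⟩ := hS.exists_empty_mem hV
    obtain ⟨b, hb, b', hb'⟩ := hS.exists_nonempty_mem hV
    obtain ⟨Y, hY⟩ := exists_sec Z a V
    obtain ⟨X, hX⟩ := exists_sec Z b V
    refine ⟨Y, hY.1, (h3 M V C W U hV hS _ G (hF' Y hY.1) hG).2 ⟨X, hX.1, fun v hv => ?_⟩⟩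
    obtain ⟨u, hu, hau, hvu, hpa⟩ := hS.prod hV ha hv
    obtain ⟨u', hu', hbu', hvu', hpb⟩ := hS.prod hV hb hv
    obtain ⟨w, hw, huw, huw'⟩ := hS.upper hu hu'
    obtain ⟨y, -, hy, z, -, hz, hR⟩ := h w hw a (huw a hau) b (huw' b hbu') ha'
      (fun h => h b' hb') v hv
      ⟨hvu.trans huw, fun t ht => (hpa t ht).imp fun p hp => ⟨huw _ hp.1, hp.2⟩⟩
      ⟨hvu'.trans huw', fun t ht => (hpb t ht).imp fun p hp => ⟨huw' _ hp.1, hp.2⟩⟩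
    refine h2 M V C W U _ _ G z X v (hag fun t ht => ?_) (fun t ht => ?_) hR
    · rw [hy.2 t ht, hY.2 t (hS.sub hV hv t ht)]
    · rw [hz.2 t ht, hX.2 t (hS.sub hV hv t ht)]

/-- Universal quantification over an element that may be empty or nonempty yields both conjuncts, so
the merging of the two witnesses is left to `Rep.all`. -/
theorem and {P Q : Pred m n} (h : Rep P) (h' : Rep Q) :
    Rep (fun M _ V F G => P M V F G ∧ Q M V F G : Pred m n) := by
  refine (h.cases h').all.congr fun M _ _ V C W U hV hS F G hF hG => ?_
  simp only [Fin.snoc_last, Fin.init_snoc]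
  obtain ⟨a, ha, ha'⟩ := hS.exists_empty_mem hV
  obtain ⟨b, hb, b', hb'⟩ := hS.exists_nonempty_mem hV
  exact ⟨fun h x _ => ⟨fun _ => h.1, fun _ => h.2⟩,
    fun h => ⟨(h a ha).1 ha', (h b hb).2 fun h => h b' hb'⟩⟩

/-- The element is replaced by a nonempty set of elements that all satisfy `P`: the choice of the
set is absorbed into `Z`, and nonemptiness is made local by `nonempty`. -/
theorem ex {P : Pred m (n + 1)} (h : Rep P) :
    Rep (fun M _ V F G => ∃ x, x ε V ∧ P M V F (Fin.snoc (α := fun _ => M) G x) : Pred m n) := by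
  refine (nonempty.and h.mem_imp.all).ex₂.congr fun M _ _ V C W U hV hS F G hF hG => ?_
  simp only [Fin.snoc_last, Fin.init_snoc]
  constructor
  · rintro ⟨x, hx, hP⟩
    obtain ⟨Y, hY⟩ := exists_bup x x
    refine ⟨Y, fun t ht => ?_, ⟨x, hY.1⟩, fun t _ ht => ?_⟩
    all_goals
      obtain rfl := (hY.2.2 t ht).elim id id
      assumption
  · rintro ⟨Y, hY, ⟨x, hx⟩, h⟩
    exact ⟨x, hY x hx, h x (hY x hx) hx⟩

/-- Dual to the conjunction: the element found selects a disjunct by being empty or not. -/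
theorem or {P Q : Pred m n} (h : Rep P) (h' : Rep Q) :
    Rep (fun M _ V F G => P M V F G ∨ Q M V F G : Pred m n) := by
  refine (h.cases h').ex.congr fun M _ _ V C W U hV hS F G hF hG => ?_
  simp only [Fin.snoc_last, Fin.init_snoc]
  obtain ⟨a, ha, ha'⟩ := hS.exists_empty_mem hV
  obtain ⟨b, hb, b', hb'⟩ := hS.exists_nonempty_mem hV
  constructor
  · rintro (h | h)
    · exact ⟨a, ha, fun _ => h, fun h' => (h' ha').elim⟩
    · exact ⟨b, hb, fun h' => (h' b' hb').elim, fun _ => h⟩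
  · rintro ⟨x, -, h, h'⟩
    by_cases hx : ∀ y, y ε x → False
    · exact .inl (h hx)
    · exact .inr (h' hx)

end Rep

/-! ## Second-order formulas -/

namespace SOFml

/-- Satisfaction in `⟨V, ∈⟩`, with full second-order semantics. -/
def Sat {M : Type} [setLang.Structure M] (V : M) :
    {m n : ℕ} → SOFml m n → (Fin m → M) → (Fin n → M) → Prop
  | _, _, falsum, _, _ => False
  | _, _, mem x y, _, G => G x ε G y
  | _, _, eq x y, _, G => G x = G y
  | _, _, memSet x X, F, G => G x ε F X
  | _, _, eqSet X Y, F, _ => F X = F Y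
  | _, _, imp φ χ, F, G => φ.Sat V F G → χ.Sat V F G
  | _, _, all₁ φ, F, G => ∀ x, x ε V → φ.Sat V F (Fin.snoc (α := fun _ => M) G x)
  | _, _, all₂ φ, F, G => ∀ X, Sub X V → φ.Sat V (Fin.snoc (α := fun _ => M) F X) G

theorem snoc_comp_snoc {M : Type} {k N : ℕ} (g : Fin k → Fin N) (xs : Fin N → M) (x : M) :
    (fun j => (Fin.snoc xs x : Fin (N + 1) → M)
      (Fin.snoc (α := fun _ : Fin (k + 1) => Fin (N + 1)) (fun i => (g i).up) (Fin.last N) j)) =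
    Fin.snoc (α := fun _ => M) (fun j => xs (g j)) x := by
  funext j
  refine Fin.lastCases ?_ (fun j => ?_) j <;> simp

theorem realize_satIn {M : Type} [setLang.Structure M] {m n N : ℕ} (φ : SOFml m n) (V : Fin N)
    (F : Fin m → Fin N) (G : Fin n → Fin N) (v : Empty → M) (xs : Fin N → M) :
    (φ.satIn V F G).Realize v xs ↔
      φ.Sat (xs V) (fun j => xs (F j)) (fun j => xs (G j)) := by
  induction φ generalizing N with
  | falsum => exact Iff.rfl
  | mem x y => simp [satIn, Sat]
  | eq x y => simp [satIn, Sat]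
  | memSet x X => simp [satIn, Sat]
  | eqSet X Y => simp [satIn, Sat]
  | imp φ χ h h' => simp [satIn, Sat, h, h']
  | all₁ φ h => simp [satIn, Sat, h, snoc_comp_snoc]
  | all₂ φ h => simp [satIn, Sat, h, snoc_comp_snoc]

/-- Closure under negation is not available for represented predicates, so the induction carries
each formula together with its negation. -/
theorem rep_of_isFirstOrder {m n : ℕ} (φ : SOFml m n) (h : φ.IsFirstOrder) :
    Rep (fun _ _ V F G => φ.Sat V F G : Pred m n) ∧
      Rep (fun _ _ V F G => ¬ φ.Sat V F G : Pred m n) := by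
  induction φ with
  | falsum =>
    exact ⟨.of_elements (fun _ _ _ => D0.false) fun _ _ _ _ _ _ h => h,
      .of_elements (fun _ _ _ => D0.not (h := D0.false)) fun _ _ _ _ _ _ h => h⟩
  | mem x y =>
    exact ⟨.of_elements (fun _ _ _ => D0.mem _ _) fun _ _ _ _ _ _ h => h,
      .of_elements (fun _ _ _ => D0.not (h := D0.mem _ _)) fun _ _ _ _ _ _ h => h⟩
  | eq x y =>
    exact ⟨.of_elements (fun _ _ _ => D0.eq _ _) fun _ _ _ _ _ _ h => h,
      .of_elements (fun _ _ _ => D0.not (h := D0.eq _ _)) fun _ _ _ _ _ _ h => h⟩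
  | memSet x X => exact ⟨Rep.memSet x X, Rep.not_memSet x X⟩
  | @eqSet m n X Y =>
    have hl : ∀ X : Fin m, Rep (fun _ _ _ F G => G (Fin.last n) ε F X : Pred m (n + 1)) :=
      Rep.memSet _
    have hn : ∀ X : Fin m, Rep (fun _ _ _ F G => ¬ G (Fin.last n) ε F X : Pred m (n + 1)) :=
      Rep.not_memSet _
    constructor
    · refine (((hl X).and (hl Y)).or ((hn X).and (hn Y))).all.congr
        fun M _ _ V C W U hV hS F G hF hG => ?_
      simp only [Fin.snoc_last, Sat]
      refine ⟨fun h x _ => by rw [h]; tauto, fun h => ext fun z => ⟨fun hz => ?_, fun hz => ?_⟩⟩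
      · have := h z (hF _ z hz)
        tauto
      · have := h z (hF _ z hz)
        tauto
    · refine (((hl X).and (hn Y)).or ((hn X).and (hl Y))).ex.congr
        fun M _ _ V C W U hV hS F G hF hG => ?_
      simp only [Fin.snoc_last, Sat]
      constructor
      · intro h
        by_contra! h'
        refine h (ext fun z => ⟨fun hz => ?_, fun hz => ?_⟩)
        · have := h' z (hF _ z hz)
          tauto
        · have := h' z (hF _ z hz)
          tauto
      · rintro ⟨x, -, h⟩ heq
        rw [heq] at h
        tauto
  | imp φ χ ihφ ihχ =>
    refine ⟨((ihφ h.1).2.or (ihχ h.2).1).congr fun M _ _ V C W U hV hS F G hF hG => ?_,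
      ((ihφ h.1).1.and (ihχ h.2).2).congr fun M _ _ V C W U hV hS F G hF hG => ?_⟩
    · simp only [Sat]
      tauto
    · simp only [Sat]
      tauto
  | all₁ φ ih =>
    refine ⟨(ih h).1.all, (ih h).2.ex.congr fun M _ _ V C W U hV hS F G hF hG => ?_⟩
    simp only [Sat]
    push Not
    rfl
  | all₂ φ ih => exact h.elim

theorem rep_not_of_isPi11 {m n : ℕ} {φ : SOFml m n} (h : φ.IsPi11) :
    Rep (fun _ _ V F G => ¬ φ.Sat V F G : Pred m n) := by
  induction h with
  | base h => exact (rep_of_isFirstOrder _ h).2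
  | all _ ih =>
    refine ih.ex₂.congr fun M _ _ V C W U hV hS F G hF hG => ?_
    simp only [Sat]
    push Not
    rfl

end SOFml
/-! ## Well-founded relations and dependent choice in a model of ZFC -/

section Recursion

variable {M : Type} [setLang.Structure M] [ZFCM M]

/-- A definable relation on a set admits an `∈`-valued rank function, or the set has a nonempty
subset without minimal elements. -/
theorem exists_rank_or_descending (Lt : M → M → Prop) [Df (fun e => Lt (e 1) (e 0))] (T : M) :
    (∃ r, (∀ t, t ε T → ∃ ρ, PM t ρ r) ∧ ∀ t ρ, PM t ρ r → ∀ s, s ε T → Lt s t →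
      ∃ σ, σ ε ρ ∧ PM s σ r) ∨
    ∃ D, (∃ t, t ε D) ∧ Sub D T ∧ ∀ t, t ε D → ∃ s, s ε D ∧ Lt s t := by
  have := Df.subst₂ Lt
  -- Attempts at a Mostowski collapse: the domain is closed under predecessors, and each value is
  -- the set of the values at the predecessors.
  let Att : M → Prop := fun g => ∀ t ρ, PM t ρ g → t ε T ∧ (∀ s, s ε T → Lt s t → ∃ σ, PM s σ g) ∧
    ∀ σ, σ ε ρ ↔ ∃ s, s ε T ∧ Lt s t ∧ PM s σ g
  have huniq : ∀ g g', Att g → Att g' → ∀ t ρ ρ', PM t ρ g → PM t ρ' g' → ρ = ρ' := by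
    intro g g' hg hg' t ρ ρ' h h'
    obtain ⟨D, hD⟩ := exists_range g
    -- The induction runs over the values, along `∈`, because `Lt` need not be well-founded.
    refine mem_induction (fun ρ => ∀ t ρ', PM t ρ g → PM t ρ' g' → ρ = ρ') D ?_ ρ
      ((hD ρ).2 ⟨t, h⟩) t ρ' h h'
    intro ρ hρ ih t ρ' h h'
    obtain ⟨-, h2, h3⟩ := hg t ρ h
    obtain ⟨-, h2', h3'⟩ := hg' t ρ' h'
    refine ext fun σ => ⟨fun hσ => ?_, fun hσ => ?_⟩
    · obtain ⟨s, hs, hst, hsσ⟩ := (h3 σ).1 hσ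
      obtain ⟨σ', hσ'⟩ := h2' s hs hst
      rw [ih σ hσ ((hD σ).2 ⟨s, hsσ⟩) s σ' hsσ hσ']
      exact (h3' σ').2 ⟨s, hs, hst, hσ'⟩
    · obtain ⟨s, hs, hst, hsσ⟩ := (h3' σ).1 hσ
      obtain ⟨σ', hσ'⟩ := h2 s hs hst
      have hσ'ρ : σ' ε ρ := (h3 σ').2 ⟨s, hs, hst, hσ'⟩
      rwa [← ih σ' hσ'ρ ((hD σ').2 ⟨s, hσ'⟩) s σ hσ' hsσ]
  -- The union of all attempts; it is a set by uniqueness and replacement.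
  obtain ⟨r, hr⟩ := exists_replacement (fun t p => ∃ ρ, OP p t ρ ∧ ∃ g, Att g ∧ PM t ρ g)
    (by
      rintro t p q ⟨ρ, hp, g, hg, h⟩ ⟨ρ', hq, g', hg', h'⟩
      obtain rfl := huniq g g' hg hg' t ρ ρ' h h'
      exact hp.unique hq) T
  have hval : ∀ t ρ, PM t ρ r ↔ ∃ g, Att g ∧ PM t ρ g := by
    intro t ρ
    obtain ⟨p, hp⟩ := exists_op t ρ
    rw [hp.pm, hr]
    constructor
    · rintro ⟨t', -, ρ', hp', h⟩
      rwa [hp.left hp', hp.right hp']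
    · rintro ⟨g, hg, h⟩
      exact ⟨t, (hg t ρ h).1, ρ, hp, g, hg, h⟩
  have hatt : Att r := by
    intro t ρ h
    obtain ⟨g, hg, h⟩ := (hval t ρ).1 h
    obtain ⟨h1, h2, h3⟩ := hg t ρ h
    refine ⟨h1, fun s hs hst => (h2 s hs hst).imp fun σ hσ => (hval s σ).2 ⟨g, hg, hσ⟩,
      fun σ => (h3 σ).trans ⟨fun ⟨s, hs, hst, hσ⟩ => ⟨s, hs, hst, (hval s σ).2 ⟨g, hg, hσ⟩⟩, ?_⟩⟩
    rintro ⟨s, hs, hst, hσ⟩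
    obtain ⟨g', hg', hσ'⟩ := (hval s σ).1 hσ
    obtain ⟨σ', hσ''⟩ := h2 s hs hst
    obtain rfl := huniq g g' hg hg' s σ' σ hσ'' hσ'
    exact ⟨s, hs, hst, hσ''⟩
  -- A minimal unranked element could be added to `r` as one more pair, giving a larger attempt. So
  -- the unranked elements, if any, have no minimal one.
  obtain ⟨D, hD⟩ := sep (fun t => ¬ ∃ ρ, PM t ρ r) T
  by_cases hne : ∃ t, t ε D
  · refine .inr ⟨D, hne, fun t ht => ((hD t).1 ht).1, fun t ht => ?_⟩
    obtain ⟨htT, htr⟩ := (hD t).1 ht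
    by_contra! hno
    have hall : ∀ s, s ε T → Lt s t → ∃ σ, PM s σ r := by
      intro s hs hst
      by_contra h
      exact hno s ((hD s).2 ⟨hs, h⟩) hst
    obtain ⟨D', hD'⟩ := exists_range r
    obtain ⟨ρ, hρ⟩ := sep (fun σ => ∃ s, s ε T ∧ Lt s t ∧ PM s σ r) D'
    obtain ⟨p, hp⟩ := exists_op t ρ
    obtain ⟨g, hg⟩ := exists_insert r p
    have hgv : ∀ s σ, PM s σ g ↔ PM s σ r ∨ (s = t ∧ σ = ρ) := by
      intro s σ
      constructor
      · rintro ⟨q, hq, hq'⟩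
        rcases (hg q).1 hq with h | rfl
        · exact .inl ⟨q, h, hq'⟩
        · exact .inr ⟨hq'.left hp, hq'.right hp⟩
      · rintro (⟨q, hq, hq'⟩ | ⟨rfl, rfl⟩)
        · exact ⟨q, (hg q).2 (.inl hq), hq'⟩
        · exact ⟨p, (hg p).2 (.inr rfl), hp⟩
    refine htr ⟨ρ, (hval t ρ).2 ⟨g, ?_, (hgv t ρ).2 (.inr ⟨rfl, rfl⟩)⟩⟩
    intro t' ρ' h
    rcases (hgv t' ρ').1 h with h | ⟨rfl, rfl⟩
    · obtain ⟨h1, h2, h3⟩ := hatt t' ρ' h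
      refine ⟨h1, fun s hs hst => (h2 s hs hst).imp fun σ hσ => (hgv s σ).2 (.inl hσ),
        fun σ => (h3 σ).trans (exists_congr fun s => and_congr_right fun hs =>
          and_congr_right fun hst => ?_)⟩
      rw [hgv]
      refine (or_iff_left ?_).symm
      rintro ⟨rfl, -⟩
      exact htr (h2 s hs hst)
    · refine ⟨htT, fun s hs hst => (hall s hs hst).imp fun σ hσ => (hgv s σ).2 (.inl hσ),
        fun σ => (hρ σ).trans ⟨fun ⟨_, s, hs, hst, hσ⟩ => ⟨s, hs, hst, (hgv s σ).2 (.inl hσ)⟩, ?_⟩⟩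
      rintro ⟨s, hs, hst, hσ⟩
      rcases (hgv s σ).1 hσ with h | ⟨rfl, -⟩
      · exact ⟨(hD' σ).2 ⟨s, h⟩, s, hs, hst, h⟩
      · exact (htr (hall s hs hst)).elim
  · refine .inl ⟨r, fun t ht => ?_, fun t ρ h s hs hst => ?_⟩
    · by_contra h
      exact hne ⟨t, (hD t).2 ⟨ht, h⟩⟩
    · obtain ⟨-, h2, h3⟩ := hatt t ρ h
      obtain ⟨σ, hσ⟩ := h2 s hs hst
      exact ⟨σ, (h3 σ).2 ⟨s, hs, hst, hσ⟩, hσ⟩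

/-! ### Successors, `ω` and dependent choice -/

/-- `n = k ∪ {k}` -/
def IsSucc (n k : M) : Prop := ∀ z, z ε n ↔ z ε k ∨ z = k

instance IsSucc.df {s t : (ℕ → M) → M} [Tm s] [Tm t] : Df (fun e => IsSucc (s e) (t e)) := by
  unfold IsSucc; infer_instance

theorem IsSucc.inj {n k k' : M} (h : IsSucc n k) (h' : IsSucc n k') : k = k' := by
  rcases (h' k).1 ((h k).2 (.inr rfl)) with h1 | h1
  · rcases (h k').1 ((h' k').2 (.inr rfl)) with h2 | h2
    · exact (mem_asymm h1 h2).elim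
    · exact h2.symm
  · exact h1

/-- `a` is a nonzero limit ordinal. -/
def LimOrd (a : M) : Prop := Ord a ∧ (∃ x, x ε a) ∧ ∀ x, x ε a → ∃ y, y ε a ∧ x ε y

/-- `w = ω` -/
def Omega (w : M) : Prop := LimOrd w ∧ ∀ x, x ε w → ¬ LimOrd x

omit [ZFCM M] in
theorem Ord.of_mem {a x : M} (h : Ord a) (hx : x ε a) : Ord x :=
  ⟨h.2 x hx, fun y hy => h.2 y (h.1 x hx y hy)⟩

omit [ZFCM M] in
theorem Ord.succ {n k : M} (h : Ord k) (hn : IsSucc n k) : Ord n := by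
  refine ⟨fun x hx y hy => (hn y).2 ?_, fun x hx => ?_⟩
  · rcases (hn x).1 hx with hx | rfl
    · exact .inl (h.1 x hx y hy)
    · exact .inl hy
  · rcases (hn x).1 hx with hx | rfl
    · exact h.2 x hx
    · exact h.1

namespace Omega

variable {w : M} (hw : Omega w)
include hw

omit [ZFCM M] in
theorem ord : Ord w := hw.1.1

/-- A nonempty element of `ω` is not a limit, so it contains some `k` with nothing above it; by
trichotomy it is `k ∪ {k}`. -/
theorem cases {n : M} (hn : n ε w) : (∀ x, ¬ x ε n) ∨ ∃ k, k ε w ∧ IsSucc n k := by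
  by_contra! ⟨⟨x, hx⟩, h⟩
  have hno := hw.ord.of_mem hn
  refine hw.2 n hn ⟨hno, ⟨x, hx⟩, fun k hk => ?_⟩
  by_contra! hk'
  refine h k (hw.ord.1 n hn k hk) fun z => ⟨fun hz => ?_, ?_⟩
  · rcases (hno.of_mem hz).trichotomy (hno.of_mem hk) with h | h | h
    · exact .inl h
    · exact .inr h
    · exact (hk' z hz h).elim
  · rintro (hz | rfl)
    · exact hno.1 k hk z hz
    · exact hk

theorem succ {n k : M} (hk : k ε w) (hn : IsSucc n k) : n ε w := by
  obtain ⟨y, hy, hky⟩ := hw.1.2.2 k hk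
  rcases ((hw.ord.of_mem hk).succ hn).trichotomy (hw.ord.of_mem hy) with h | rfl | h
  · exact hw.ord.1 y hy n h
  · exact hy
  · rcases (hn y).1 h with h | rfl
    · exact (mem_asymm hky h).elim
    · exact (mem_irrefl _ hky).elim

theorem zero_mem {z : M} (hz : ∀ x, ¬ x ε z) : z ε w := by
  obtain ⟨n, hn, hn'⟩ := exists_minimal w hw.1.2.1
  have : z = n := ext fun x => ⟨fun h => (hz x h).elim,
    fun h => (hn' x h (hw.ord.1 n hn x h)).elim⟩
  rwa [this]

/-- Dependent choice: a definable relation without minimal elements on `D` has a descending sequence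
of length `ω`. -/
theorem exists_descending (Lt : M → M → Prop) [Df (fun e => Lt (e 1) (e 0))] (D : M)
    (hne : ∃ t, t ε D) (hD : ∀ t, t ε D → ∃ s, s ε D ∧ Lt s t) :
    ∃ G, (∀ n t, PM n t G → n ε w ∧ t ε D) ∧ (∀ n, n ε w → ∃ t, PM n t G) ∧
      (∀ n t t', PM n t G → PM n t' G → t = t') ∧
      ∀ k n s t, IsSucc n k → PM k s G → PM n t G → Lt t s := by
  have := Df.subst₂ Lt
  obtain ⟨t₀, ht₀⟩ := hne
  obtain ⟨z, hz⟩ := @exists_empty M _ _ ⟨w⟩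
  obtain ⟨c, hc⟩ := exists_choose (fun t s => Lt s t) D D hD
  -- The sequence `G` is the least relation that contains the starting pair and is closed under one
  -- step of the choice function `c`.
  let Cl : M → Prop := fun S => PM z t₀ S ∧ ∀ k n s t, k ε w → s ε D → t ε D → PM k s S →
    IsSucc n k → PM s t c → PM n t S
  obtain ⟨G, hG, -⟩ := exists_rel (fun n t => ∀ S, Cl S → PM n t S) w D
  have hGcl : Cl G := by
    refine ⟨(hG z t₀).2 ⟨hw.zero_mem hz, ht₀, fun S hS => hS.1⟩, fun k n s t hk hs ht hks hn hst =>
      (hG n t).2 ⟨hw.succ hk hn, ht, fun S hS =>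
        hS.2 k n s t hk hs ht (((hG k s).1 hks).2.2 S hS) hn hst⟩⟩
  have hchar : ∀ n t, PM n t G →
      (n = z ∧ t = t₀) ∨ ∃ k s, PM k s G ∧ IsSucc n k ∧ PM s t c := by
    intro n t h
    -- Restricting `G` to the pairs of the desired form leaves a closed relation, which by
    -- minimality is all of `G`.
    obtain ⟨S, hS, -⟩ := exists_rel (fun n t => PM n t G ∧
      ((n = z ∧ t = t₀) ∨ ∃ k s, PM k s G ∧ IsSucc n k ∧ PM s t c)) w D
    refine ((hS n t).1 (((hG n t).1 h).2.2 S ⟨(hS z t₀).2 ?_, ?_⟩)).2.2.2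
    · exact ⟨hw.zero_mem hz, ht₀, hGcl.1, .inl ⟨rfl, rfl⟩⟩
    · intro k n s t hk hs ht hks hn hst
      have hksG := ((hS k s).1 hks).2.2.1
      exact (hS n t).2 ⟨hw.succ hk hn, ht, hGcl.2 k n s t hk hs ht hksG hn hst,
        .inr ⟨k, s, hksG, hn, hst⟩⟩
  have hzs : ∀ k, ¬ IsSucc z k := fun k h => hz k ((h k).2 (.inr rfl))
  have hcu : ∀ s t t', s ε D → PM s t c → PM s t' c → t = t' := by
    intro s t t' hs h h'
    obtain ⟨y, -, -, -, hy⟩ := hc s hs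
    rw [hy t h, hy t' h']
  have hfun : ∀ n t t', PM n t G → PM n t' G → t = t' := by
    intro n t t' h h'
    refine mem_induction (fun n => ∀ t t', PM n t G → PM n t' G → t = t') w ?_ n
      ((hG n t).1 h).1 t t' h h'
    intro n hn ih t t' h h'
    rcases hchar n t h with ⟨rfl, rfl⟩ | ⟨k, s, hks, hnk, hst⟩
    · rcases hchar n t' h' with ⟨-, rfl⟩ | ⟨k, s, -, hnk, -⟩
      · rfl
      · exact (hzs k hnk).elim
    · rcases hchar n t' h' with ⟨rfl, -⟩ | ⟨k', s', hks', hnk', hst'⟩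
      · exact (hzs k hnk).elim
      · obtain rfl := hnk.inj hnk'
        have hk := ((hG k s).1 hks)
        obtain rfl := ih k ((hnk k).2 (.inr rfl)) hk.1 s s' hks hks'
        exact hcu s t t' hk.2.1 hst hst'
  refine ⟨G, fun n t h => ⟨((hG n t).1 h).1, ((hG n t).1 h).2.1⟩, ?_, hfun, ?_⟩
  · refine mem_induction (fun n => ∃ t, PM n t G) w fun n hn ih => ?_
    rcases hw.cases hn with h | ⟨k, hk, hnk⟩
    · have : n = z := ext fun x => ⟨fun hx => (h x hx).elim, fun hx => (hz x hx).elim⟩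
      exact ⟨t₀, this ▸ hGcl.1⟩
    · obtain ⟨s, hs⟩ := ih k ((hnk k).2 (.inr rfl)) hk
      have hsD := ((hG k s).1 hs).2.1
      obtain ⟨t, ht, -, hst, -⟩ := hc s hsD
      exact ⟨t, hGcl.2 k n s t hk hsD ht hs hnk hst⟩
  · intro k n s t hnk hs ht
    rcases hchar n t ht with ⟨rfl, -⟩ | ⟨k', s', hks', hnk', hst'⟩
    · exact (hzs k hnk).elim
    · obtain rfl := hnk.inj hnk'
      obtain rfl := hfun k s s' hs hks'
      obtain ⟨y, -, hy, -, hy'⟩ := hc s ((hG k s).1 hs).2.1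
      rwa [hy' t hst']

end Omega

end Recursion
/-! ## The tree of approximations -/

section Tree

variable {m n : ℕ}

/-- `z` is a subset of the level `u` that satisfies `R` up to `u`. -/
def Node (R : Rel m n) (M : Type) [setLang.Structure M] (V C W U : M) (F : Fin m → M)
    (G : Fin n → M) (z u : M) : Prop :=
  Sub z u ∧ ∀ v, v ε C → Sub v u → R M V C W U F G z v

instance Node.d0R (R : Rel m n) [D0R R] : D0R (Node R) :=
  ⟨fun v c w q F G z u => by unfold Node; infer_instance⟩

instance Agree.d0 (i j k : ℕ) : D0 (fun _ _ e => Agree (e i) (e j) (e k)) := by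
  unfold Agree; infer_instance

instance Agree.df {M : Type} [setLang.Structure M] {s t r : (ℕ → M) → M} [Tm s] [Tm t] [Tm r] :
    Df (fun e => Agree (s e) (t e) (r e)) := by
  unfold Agree; infer_instance

/-- The node `⟨u', z'⟩` extends `⟨u, z⟩`. -/
def Ext {M : Type} [setLang.Structure M] (u z u' z' : M) : Prop := u ε u' ∧ Sub u u' ∧ Agree u z z'

instance Ext.d0 (i j k l : ℕ) : D0 (fun _ _ e => Ext (e i) (e j) (e k) (e l)) := by
  unfold Ext; infer_instance

instance Ext.df {M : Type} [setLang.Structure M] {s t r q : (ℕ → M) → M} [Tm s] [Tm t] [Tm r]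
    [Tm q] : Df (fun e => Ext (s e) (t e) (r e) (q e)) := by
  unfold Ext; infer_instance

/-- `r` is an `∈`-valued ranking, with values in `D`, of the tree of nodes. -/
def Cert (R : Rel m n) (M : Type) [setLang.Structure M] (V C W U : M) (F : Fin m → M)
    (G : Fin n → M) (r D : M) : Prop :=
  (∀ u, u ε C → ∀ z, z ε V → Node R M V C W U F G z u →
    ∃ t, t ε V ∧ OP t u z ∧ ∃ ρ, ρ ε D ∧ PM t ρ r) ∧
  ∀ u, u ε C → ∀ z, z ε V → ∀ u', u' ε C → ∀ z', z' ε V → Node R M V C W U F G z u →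
    Node R M V C W U F G z' u' → Ext u z u' z' → ∀ t, t ε V → ∀ t', t' ε V → OP t u z →
    OP t' u' z' → ∀ ρ, ρ ε D → PM t ρ r → ∃ σ, σ ε ρ ∧ σ ε D ∧ PM t' σ r

instance Cert.d0R (R : Rel m n) [D0R R] : D0R (Cert R) :=
  ⟨fun v c w q F G z u => by unfold Cert; infer_instance⟩

variable {M : Type} [setLang.Structure M] [ZFCM M] {V C W U : M} {R : Rel m n} [D0R R]
  {F : Fin m → M} {G : Fin n → M}

omit [ZFCM M] in
theorem Sys.exists_mem_level (hS : Sys V C W U) {u : M} (hu : u ε C) :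
    ∃ v, v ε C ∧ u ε v ∧ Sub u v := by
  obtain ⟨v, hv, huv, h⟩ := hS.pow hu
  exact ⟨v, hv, h u (hS.mem hu) (Sub.refl u), huv⟩

omit [D0R R] in
/-- A ranked tree has no branch. -/
theorem Cert.not_exists {r D : M} (hR : Loc R) (hV : Nice V) (hS : Sys V C W U)
    (h : Cert R M V C W U F G r D) : ¬ ∃ Z, Sub Z V ∧ ∀ u, u ε C → R M V C W U F G Z u := by
  rintro ⟨Z, hZ, hZR⟩
  have hnode : ∀ u, u ε C → ∃ z, z ε V ∧ (∀ x, x ε z ↔ x ε u ∧ x ε Z) ∧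
      Node R M V C W U F G z u := by
    intro u hu
    obtain ⟨z, hz⟩ := sep (fun x => x ε Z) u
    have hzu : Sub z u := fun x hx => ((hz x).1 hx).1
    refine ⟨z, hV.2 u (hS.mem hu) z hzu, hz, hzu, fun v hv hvu => ?_⟩
    refine hR M V C W U F F G Z z v (fun _ => Agree.refl _ _) (fun x hx => ?_) (hZR v hv)
    rw [hz, and_iff_right (hvu x hx)]
  -- The ranks of the traces `Z ∩ u` of the branch. Foundation gives a minimal one, but the trace on
  -- a level that has `u` as an element has a rank inside it.
  obtain ⟨B, hB⟩ := sep (fun ρ => ∃ u, u ε C ∧ ∃ z, (∀ x, x ε z ↔ x ε u ∧ x ε Z) ∧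
    ∃ t, t ε V ∧ OP t u z ∧ PM t ρ r) D
  obtain ⟨u, hu⟩ := hS.exists_level
  obtain ⟨z, hz, hzZ, hn⟩ := hnode u hu
  obtain ⟨t, ht, htp, ρ, hρ, htρ⟩ := h.1 u hu z hz hn
  obtain ⟨ρ, hρ, hmin⟩ := exists_minimal B ⟨ρ, (hB ρ).2 ⟨hρ, u, hu, z, hzZ, t, ht, htp, htρ⟩⟩
  obtain ⟨hρD, u, hu, z, hzZ, t, ht, htp, htρ⟩ := (hB ρ).1 hρ
  obtain ⟨z₁, hz₁, hzZ₁, hn⟩ := hnode u hu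
  obtain rfl : z = z₁ := ext fun x => (hzZ x).trans (hzZ₁ x).symm
  obtain ⟨u', hu', huu', hsub⟩ := hS.exists_mem_level hu
  obtain ⟨z', hz', hzZ', hn'⟩ := hnode u' hu'
  obtain ⟨t', ht', htp', -⟩ := h.1 u' hu' z' hz' hn'
  obtain ⟨σ, hσ, hσD, htσ⟩ := h.2 u hu z hz₁ u' hu' z' hz' hn hn' ⟨huu', hsub, fun x hx => by
    rw [hzZ, hzZ', and_iff_right hx, and_iff_right (hsub x hx)]⟩ t ht t' ht' htp htp' ρ hρD htρ
  exact hmin σ hσ ((hB σ).2 ⟨hσD, u', hu', z', hzZ', t', ht', htp', htσ⟩)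

/-- The indices are the elements of `ω`, and the levels increase with the index. -/
def Tower (C W U : M) : Prop :=
  Omega W ∧ ∀ k, k ε W → ∀ l, l ε W → k ε l → ∀ u, u ε C → ∀ v, v ε C → PM k u U → PM l v U → Sub u v

/-- A tree without branches, whose levels form a tower, is ranked. -/
theorem exists_cert (hR : Loc R) (hV : Nice V) (hS : Sys V C W U) (hT : Tower C W U)
    (h : ¬ ∃ Z, Sub Z V ∧ ∀ u, u ε C → R M V C W U F G Z u) :
    ∃ r D, Cert R M V C W U F G r D := by
  obtain ⟨T, hTn⟩ := sep (fun t => ∃ u z, OP t u z ∧ u ε C ∧ z ε V ∧ Node R M V C W U F G z u) V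
  let Lt : M → M → Prop := fun t' t => ∃ u z u' z', OP t u z ∧ OP t' u' z' ∧ Ext u z u' z'
  rcases exists_rank_or_descending Lt T with ⟨r, hr, hr'⟩ | ⟨D, hne, hDT, hD⟩
  · obtain ⟨D, hD⟩ := exists_range r
    have hnT : ∀ u, u ε C → ∀ z, z ε V → Node R M V C W U F G z u → ∀ t, OP t u z → t ε T :=
      fun u hu z hz hn t ht => (hTn t).2 ⟨hS.op_mem hV (hS.mem hu) hz ht, u, z, ht, hu, hz, hn⟩
    refine ⟨r, D, fun u hu z hz hn => ?_, fun u hu z hz u' hu' z' hz' hn hn' hext t ht t' ht' hp hp'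
      ρ hρ htρ => ?_⟩
    · obtain ⟨t, ht⟩ := exists_op u z
      obtain ⟨ρ, hρ⟩ := hr t (hnT u hu z hz hn t ht)
      exact ⟨t, hS.op_mem hV (hS.mem hu) hz ht, ht, ρ, (hD ρ).2 ⟨t, hρ⟩, hρ⟩
    · obtain ⟨σ, hσ, htσ⟩ := hr' t ρ htρ t' (hnT u' hu' z' hz' hn' t' hp')
        ⟨u, z, u', z', hp, hp', hext⟩
      exact ⟨σ, hσ, (hD σ).2 ⟨t', htσ⟩, htσ⟩
  refine (h ?_).elim
  obtain ⟨hw, hmono⟩ := hT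
  obtain ⟨S, hS1, hS2, hS3, hS4⟩ := hw.exists_descending Lt D hne hD
  let Lev : M → M → M → Prop := fun k u z => ∃ t, PM k t S ∧ OP t u z
  have hlev : ∀ k, k ε W → ∃ u z, Lev k u z := by
    intro k hk
    obtain ⟨t, ht⟩ := hS2 k hk
    obtain ⟨-, u, z, hp, -⟩ := (hTn t).1 (hDT t (hS1 k t ht).2)
    exact ⟨u, z, t, ht, hp⟩
  have hlevn : ∀ k u z, Lev k u z → k ε W ∧ u ε C ∧ z ε V ∧ Node R M V C W U F G z u := by
    rintro k u z ⟨t, ht, hp⟩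
    obtain ⟨-, u', z', hp', hu, hz, hn⟩ := (hTn t).1 (hDT t (hS1 k t ht).2)
    obtain rfl := hp.left hp'
    obtain rfl := hp.right hp'
    exact ⟨(hS1 k t ht).1, hu, hz, hn⟩
  have hlevu : ∀ k u z u' z', Lev k u z → Lev k u' z' → u = u' ∧ z = z' := by
    rintro k u z u' z' ⟨t, ht, hp⟩ ⟨t', ht', hp'⟩
    obtain rfl := hS3 k t t' ht ht'
    exact ⟨hp.left hp', hp.right hp'⟩
  have hstep : ∀ k l u z u' z', IsSucc l k → Lev k u z → Lev l u' z' → Ext u z u' z' := by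
    rintro k l u z u' z' hl ⟨t, ht, hp⟩ ⟨t', ht', hp'⟩
    obtain ⟨u₁, z₁, u₁', z₁', hp₁, hp₁', hext⟩ := hS4 k l t t' hl ht ht'
    obtain rfl := hp.left hp₁
    obtain rfl := hp.right hp₁
    obtain rfl := hp'.left hp₁'
    obtain rfl := hp'.right hp₁'
    exact hext
  have hchain : ∀ l, l ε W → ∀ k, k ε l → ∀ u z u' z', Lev k u z → Lev l u' z' →
      Sub u u' ∧ Agree u z z' := by
    refine mem_induction (fun l => ∀ k, k ε l → ∀ u z u' z', Lev k u z → Lev l u' z' →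
      Sub u u' ∧ Agree u z z') W fun l hl ih k hk u z u' z' h h' => ?_
    rcases hw.cases hl with h0 | ⟨j, hj, hlj⟩
    · exact (h0 k hk).elim
    obtain ⟨u₁, z₁, h₁⟩ := hlev j hj
    have h1 := hstep j l u₁ z₁ u' z' hlj h₁ h'
    rcases (hlj k).1 hk with hkj | rfl
    · have h2 := ih j ((hlj j).2 (.inr rfl)) hj k hkj u z u₁ z₁ h h₁
      exact ⟨h2.1.trans h1.2.1, fun x hx => (h2.2 x hx).trans (h1.2.2 x (h2.1 x hx))⟩
    · obtain ⟨rfl, rfl⟩ := hlevu k u z u₁ z₁ h h₁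
      exact h1.2
  -- The levels of the nodes increase strictly along `∈`, so the `k`-th of them has index at least
  -- `k` and includes the `k`-th level of the tower. Hence the nodes reach beyond every level.
  have hcof : ∀ k, k ε W → ∀ v, v ε C → PM k v U → ∀ u z, Lev k u z → Sub v u := by
    refine mem_induction (fun k => ∀ v, v ε C → PM k v U → ∀ u z, Lev k u z → Sub v u) W
      fun k hk ih v hv hkv u z hl => ?_
    have hu := (hlevn k u z hl).2.1
    obtain ⟨i, hi, hiu⟩ := hS.index_exists hu
    rcases (hw.ord.of_mem hi).trichotomy (hw.ord.of_mem hk) with hik | rfl | hki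
    · rcases hw.cases hk with h0 | ⟨j, hj, hkj⟩
      · exact (h0 i hik).elim
      obtain ⟨u₁, z₁, h₁⟩ := hlev j hj
      obtain ⟨v₁, hv₁, hjv₁⟩ := hS.level_exists hj
      have h1 := hstep j k u₁ z₁ u z hkj h₁ hl
      have h2 := ih j ((hkj j).2 (.inr rfl)) hj v₁ hv₁ hjv₁ u₁ z₁ h₁
      have h3 : Sub u v₁ := by
        rcases (hkj i).1 hik with hij | rfl
        · exact hmono i hi j hj hij u hu v₁ hv₁ hiu hjv₁
        · obtain rfl := hS.level_unique hi hu hv₁ hiu hjv₁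
          exact Sub.refl _
      exact (mem_irrefl u₁ (h2 u₁ (h3 u₁ h1.1))).elim
    · obtain rfl := hS.level_unique hi hv hu hkv hiu
      exact Sub.refl _
    · exact hmono k hk i hi hki v hv u hu hkv hiu
  -- The union of the nodes. By coherence it agrees with each node on its level, and locality
  -- transfers `R` to it.
  obtain ⟨Z, hZ⟩ := sep (fun x => ∃ k u z, Lev k u z ∧ x ε z) V
  refine ⟨Z, fun x hx => ((hZ x).1 hx).1, fun v hv => ?_⟩
  obtain ⟨k, hk, hkv⟩ := hS.index_exists hv
  obtain ⟨u, z, hl⟩ := hlev k hk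
  have hvu := hcof k hk v hv hkv u z hl
  obtain ⟨-, hu, hz, hn⟩ := hlevn k u z hl
  refine hR M V C W U F F G z Z v (fun _ => Agree.refl _ _) (fun x hx => ⟨fun hxz => ?_, fun hxZ => ?_⟩)
    (hn.2 v hv hvu)
  · exact (hZ x).2 ⟨hV.1 z hz x hxz, k, u, z, hl, hxz⟩
  · obtain ⟨-, l, u', z', hl', hxz'⟩ := (hZ x).1 hxZ
    obtain ⟨hlW, -, -, hn'⟩ := hlevn l u' z' hl'
    rcases (hw.ord.of_mem hlW).trichotomy (hw.ord.of_mem hk) with h | rfl | h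
    · exact ((hchain k hk l h u' z' u z hl' hl).2 x (hn'.1 x hxz')).1 hxz'
    · obtain ⟨rfl, rfl⟩ := hlevu l u z u' z' hl hl'
      exact hxz'
    · exact ((hchain l hlW k h u z u' z' hl hl').2 x (hvu x hx)).2 hxz'

end Tree
/-! ## Stages of the cumulative hierarchy with a cofinal sequence of strong limit cardinals -/

section Stage

variable {M : Type} [setLang.Structure M]

/-- `f` is a bijection from `a` onto `b`. -/
def Bij (f a b : M) : Prop := Fun f a ∧ (∀ y, y ε b ↔ ∃ x, PM x y f) ∧
  ∀ x x' y, PM x y f → PM x' y f → x = x'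

/-- `a` is a strong limit cardinal. -/
def StrongLimit (a : M) : Prop :=
  (Ord a ∧ ∀ x, x ε a → ¬ ∃ f, Bij f x a) ∧ (∃ x, x ε a) ∧
    ∀ x, x ε a → ∃ p, (∀ z, z ε p ↔ Sub z x) ∧ ∃ y, y ε a ∧ ∃ f, Bij f p y

/-- `V` is the stage `V_l` of the cumulative hierarchy. -/
def Stage (V l : M) : Prop :=
  Ord l ∧ ∃ d, IsSucc d l ∧ ∃ f, Fun f d ∧ PM l V f ∧ ∀ α, α ε d → ∀ v, PM α v f →
    ∀ x, x ε v ↔ ∃ β, β ε α ∧ ∃ u, PM β u f ∧ Sub x u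

/-- `s` is a strictly increasing sequence of strong limit cardinals with supremum `l`. -/
def StrongLimitSeq (s l : M) : Prop :=
  (∃ w, Omega w ∧ Fun s w) ∧ (∀ i a, PM i a s → StrongLimit a) ∧
    (∀ i a j b, PM i a s → PM j b s → i ε j → a ε b) ∧
    ∀ x, x ε l ↔ ∃ i a, PM i a s ∧ x ε a

section Realize

variable {n : ℕ} (v : Empty → M) (xs : Fin n → M)

@[simp] theorem realize_isSucc (a b : Fin n) :
    (isSucc a b).Realize v xs ↔ IsSucc (xs a) (xs b) := by
  simp [isSucc, IsSucc]

@[simp] theorem realize_isOrdinal (a : Fin n) : (isOrdinal a).Realize v xs ↔ Ord (xs a) := by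
  simp [isOrdinal, isTransitive, Ord, Trans]

@[simp] theorem realize_isOmega (a : Fin n) : (isOmega a).Realize v xs ↔ Omega (xs a) := by
  simp [isOmega, isLimitOrdinal, Omega, LimOrd, and_assoc]

variable [ZFCM M]

@[simp] theorem realize_isBij (f a b : Fin n) :
    (isBij f a b).Realize v xs ↔ Bij (xs f) (xs a) (xs b) := by
  simp [isBij, Bij, and_assoc]

@[simp] theorem realize_isStrongLimit (a : Fin n) :
    (isStrongLimit a).Realize v xs ↔ StrongLimit (xs a) := by
  simp [isStrongLimit, StrongLimit, isCardinal, isEquinum, isPowerset, and_assoc]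

@[simp] theorem realize_isStage (a b : Fin n) :
    (isStage a b).Realize v xs ↔ Stage (xs a) (xs b) := by
  simp [isStage, Stage, and_assoc]

@[simp] theorem realize_isStrongLimitSeq (a b : Fin n) :
    (isStrongLimitSeq a b).Realize v xs ↔ StrongLimitSeq (xs a) (xs b) := by
  simp [isStrongLimitSeq, StrongLimitSeq, and_assoc]

end Realize

variable [ZFCM M]

/-- Cantor's theorem: there is no bijection of the power set of `x` onto a subset of `x`. -/
theorem Bij.not_sub {f p x y : M} (h : Bij f p y) (hp : ∀ z, z ε p ↔ Sub z x) : ¬ Sub y x := by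
  intro hyx
  obtain ⟨D, hD⟩ := sep (fun z => ∃ S, PM S z f ∧ ¬ z ε S) y
  have hDp : D ε p := (hp D).2 fun z hz => hyx z ((hD z).1 hz).1
  obtain ⟨z, hz, -⟩ := h.1.2 D hDp
  have hzy : z ε y := (h.2.1 z).2 ⟨D, hz⟩
  by_cases hzD : z ε D
  · obtain ⟨-, S, hS, hzS⟩ := (hD z).1 hzD
    rw [h.2.2 S D z hS hz] at hzS
    exact hzS hzD
  · exact hzD ((hD z).2 ⟨hzy, D, hz, hzD⟩)

/-- If `x` were the largest element of `a`, its power set would be in bijection with some `y ∈ a`,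
hence with a subset of `x`, against Cantor. -/
theorem StrongLimit.limOrd {a : M} (h : StrongLimit a) : LimOrd a := by
  refine ⟨h.1.1, h.2.1, fun x hx => ?_⟩
  by_contra! hno
  obtain ⟨p, hp, y, hy, f, hf⟩ := h.2.2 x hx
  refine hf.not_sub hp ?_
  rcases (h.1.1.of_mem hx).trichotomy (h.1.1.of_mem hy) with h' | rfl | h'
  · exact (hno y hy h').elim
  · exact Sub.refl _
  · exact (h.1.1.of_mem hx).1 y h'

theorem Omega.sub_of_limOrd {w a : M} (hw : Omega w) (ha : LimOrd a) : Sub w a := by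
  rcases hw.ord.trichotomy ha.1 with h | rfl | h
  · exact ha.1.1 w h
  · exact Sub.refl _
  · exact (hw.2 a h ha).elim

/-- The levels are the stages `V_(λ_n)`, indexed by `n ∈ ω`; each contains all subsets of the
earlier ones. That the `λ_n` are strong limits serves only to give `ω ⊆ λ_n ⊆ V_(λ_n)`, hence `ω ∈
V_λ`. -/
theorem exists_tower {V l s : M} (hs : StrongLimitSeq s l) (hV : Stage V l) :
    Nice V ∧ ∃ C W U, Sys V C W U ∧ Tower C W U := by
  obtain ⟨⟨w, hw, hsf⟩, hsl, hsm, hsup⟩ := hs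
  obtain ⟨hl, d, hd, f, hf, hlV, hfv⟩ := hV
  have hld : l ε d := (hd l).2 (.inr rfl)
  have hlsub : ∀ α, α ε l → α ε d := fun α hα => (hd α).2 (.inl hα)
  have hdo : Ord d := hl.succ hd
  have hVm : ∀ x, x ε V ↔ ∃ β, β ε l ∧ ∃ u, PM β u f ∧ Sub x u := hfv l hld V hlV
  have hex : ∀ α, α ε d → ∃ v, PM α v f := fun α hα => (hf.2 α hα).imp fun _ h => h.1
  have hmono : ∀ α β u v, β ε d → α ε β → PM α u f → PM β v f → Sub u v ∧ u ε v := by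
    intro α β u v hβ hα hu hv
    have hαd := hdo.1 β hβ α hα
    refine ⟨fun x hx => ?_, (hfv β hβ v hv u).2 ⟨α, hα, u, hu, Sub.refl u⟩⟩
    obtain ⟨γ, hγ, t, ht, hxt⟩ := (hfv α hαd u hu x).1 hx
    exact (hfv β hβ v hv x).2 ⟨γ, (hdo.of_mem hβ).1 α hα γ hγ, t, ht, hxt⟩
  have hnice : Nice V := by
    constructor
    · intro x hx y hy
      obtain ⟨β, hβ, u, hu, hxu⟩ := (hVm x).1 hx
      exact (hmono β l u V hld hβ hu hlV).1 y (hxu y hy)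
    · intro x hx y hyx
      obtain ⟨β, hβ, u, hu, hxu⟩ := (hVm x).1 hx
      exact (hVm y).2 ⟨β, hβ, u, hu, hyx.trans hxu⟩
  have hsex : ∀ i, i ε w → ∃ a, PM i a s := fun i hi => (hsf.2 i hi).imp fun _ h => h.1
  have hsw : ∀ i a, PM i a s → i ε w := by
    rintro i a ⟨p, hp, hp'⟩
    obtain ⟨i', hi', a', hp''⟩ := hsf.1 p hp
    rwa [hp'.left hp'']
  have hsl' : ∀ i a, PM i a s → a ε l := by
    intro i a h
    obtain ⟨j, hj, hij⟩ := hw.1.2.2 i (hsw i a h)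
    obtain ⟨b, hb⟩ := hsex j hj
    exact (hsup a).2 ⟨j, b, hb, hsm i a j b h hb hij⟩
  obtain ⟨U, hU, -⟩ := exists_rel (fun i v => ∃ a, PM i a s ∧ PM a v f) w V
  obtain ⟨C, hC⟩ := sep (fun v => ∃ i, PM i v U) V
  have hlev : ∀ i a, PM i a s → ∃ v, v ε C ∧ PM a v f ∧ PM i v U := by
    intro i a h
    have ha := hsl' i a h
    obtain ⟨v, hv⟩ := hex a (hlsub a ha)
    have hvV : v ε V := (hmono a l v V hld ha hv hlV).2
    have hiv : PM i v U := (hU i v).2 ⟨hsw i a h, hvV, a, h, hv⟩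
    exact ⟨v, (hC v).2 ⟨hvV, i, hiv⟩, hv, hiv⟩
  have hUm : ∀ i j u v, i ε j → PM i u U → PM j v U → Sub u v ∧
      ∀ y, Sub y u → y ε v := by
    intro i j u v hij hiu hjv
    obtain ⟨-, -, a, ha, hau⟩ := (hU i u).1 hiu
    obtain ⟨-, -, b, hb, hbv⟩ := (hU j v).1 hjv
    have hab := hsm i a j b ha hb hij
    have hbd := hlsub b (hsl' j b hb)
    exact ⟨(hmono a b u v hbd hab hau hbv).1,
      fun y hy => (hfv b hbd v hbv y).2 ⟨a, hab, u, hau, hy⟩⟩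
  have hUu : ∀ i u v, PM i u U → PM i v U → u = v := by
    intro i u v hu hv
    obtain ⟨hi, -, a, ha, hau⟩ := (hU i u).1 hu
    obtain ⟨-, -, b, hb, hbv⟩ := (hU i v).1 hv
    obtain rfl := hsf.unique hi ha hb
    exact hf.unique (hlsub a (hsl' i a ha)) hau hbv
  have hwV : w ε V := by
    obtain ⟨i, hi⟩ := hw.1.2.1
    obtain ⟨a, ha⟩ := hsex i hi
    have hsub := hw.sub_of_limOrd (hsl i a ha).limOrd
    have key : ∀ α, α ε d → ∀ v, PM α v f → Sub α v := by
      refine mem_induction (fun α => ∀ v, PM α v f → Sub α v) d fun α hα ih v hv β hβ => ?_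
      have hβd := hdo.1 α hα β hβ
      obtain ⟨u, hu⟩ := hex β hβd
      exact (hfv α hα v hv β).2 ⟨β, hβ, u, hu, ih β hβ hβd u hu⟩
    have hal := hsl' i a ha
    obtain ⟨v, hv⟩ := hex a (hlsub a hal)
    exact (hVm w).2 ⟨a, hal, v, hv, hsub.trans (key a (hlsub a hal) v hv)⟩
  refine ⟨hnice, C, w, U, ⟨fun u hu => ((hC u).1 hu).1, fun x hx => ?_, fun u hu v hv => ?_,
    fun u hu => ?_, hwV, fun k hk => ?_, fun k _ v _ v' _ => hUu k v v', fun v hv => ?_⟩, hw,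
    fun k _ l _ hkl u _ v _ hu hv => (hUm k l u v hkl hu hv).1⟩
  · obtain ⟨β, hβ, u, hu, hxu⟩ := (hVm x).1 hx
    obtain ⟨i, a, ha, hβa⟩ := (hsup β).1 hβ
    obtain ⟨v, hv, hav, -⟩ := hlev i a ha
    have had := hlsub a (hsl' i a ha)
    exact ⟨v, hv, (hfv a had v hav x).2 ⟨β, hβa, u, hu, hxu⟩,
      hxu.trans (hmono β a u v had hβa hu hav).1⟩
  · obtain ⟨-, i, hi⟩ := (hC u).1 hu
    obtain ⟨-, j, hj⟩ := (hC v).1 hv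
    rcases (hw.ord.of_mem ((hU i u).1 hi).1).trichotomy (hw.ord.of_mem ((hU j v).1 hj).1)
      with h | rfl | h
    · exact .inl (hUm i j u v h hi hj).1
    · obtain rfl := hUu i u v hi hj
      exact .inl (Sub.refl _)
    · exact .inr (hUm j i v u h hj hi).1
  · obtain ⟨-, i, hi⟩ := (hC u).1 hu
    obtain ⟨j, hj, hij⟩ := hw.1.2.2 i ((hU i u).1 hi).1
    obtain ⟨b, hb⟩ := hsex j hj
    obtain ⟨v, hv, -, hjv⟩ := hlev j b hb
    have := hUm i j u v hij hi hjv
    exact ⟨v, hv, this.1, fun y _ => this.2 y⟩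
  · obtain ⟨a, ha⟩ := hsex k hk
    obtain ⟨v, hv, -, hkv⟩ := hlev k a ha
    exact ⟨v, hv, hkv⟩
  · obtain ⟨-, i, hi⟩ := (hC v).1 hv
    exact ⟨i, ((hU i v).1 hi).1, hi⟩

end Stage

/-! ## `Σ₁`-definitions of `Σ¹₂`-formulas -/

/-- Uniform `Σ₁`-definability of a predicate. -/
def IsS1 {m n : ℕ} (P : Pred m n) : Prop :=
  ∀ (v : ℕ) (F : Fin m → ℕ) (G : Fin n → ℕ),
    S1 (fun M _ e => P M (e v) (fun j => e (F j)) (fun j => e (G j)))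

/-- `P` and `Q` agree on the parameters from a set `V` with a tower of levels. -/
def Equivalent {m n : ℕ} (P Q : Pred m n) : Prop :=
  ∀ (M : Type) [setLang.Structure M] [ZFCM M] (V : M), Nice V →
    (∃ C W U, Sys V C W U ∧ Tower C W U) → ∀ (F : Fin m → M) (G : Fin n → M),
      (∀ j, Sub (F j) V) → (∀ j, G j ε V) → (P M V F G ↔ Q M V F G)

/-- The levels and the ranking are guessed together. `Tower` is not demanded of the guess, as a
ranking over any system refutes a branch; the tower matters only for finding a guess that succeeds.
-/
theorem Rep.exists_isS1 {m n : ℕ} {P : Pred m n} (h : Rep P) :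
    ∃ Q : Pred m n, IsS1 Q ∧ Equivalent Q fun M _ V F G => ¬ P M V F G := by
  obtain ⟨R, h1, h2, h3⟩ := h
  refine ⟨fun M _ V F G => ∃ C W U r D, Sys V C W U ∧ Cert R M V C W U F G r D,
    fun v F G => .ex (.ex (.ex (.ex (.ex .d0)))), fun M _ _ V hV hT F G hF hG => ?_⟩
  constructor
  · rintro ⟨C, W, U, r, D, hS, hc⟩
    rw [h3 M V C W U hV hS F G hF hG]
    exact hc.not_exists h2 hV hS
  · intro (hP : ¬ P M V F G)
    obtain ⟨C, W, U, hS, hT⟩ := hT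
    rw [h3 M V C W U hV hS F G hF hG] at hP
    obtain ⟨r, D, hc⟩ := exists_cert h2 hV hS hT hP
    exact ⟨C, W, U, r, D, hS, hc⟩

/-- A second-order existential quantifier is a first-order one with the `Δ₀`-bound `Y ⊆ V`, so only
the `Π¹₁` core needs the tree. -/
theorem SOFml.exists_isS1_of_isSigma12 {m n : ℕ} {ψ : SOFml m n} (h : ψ.IsSigma12) :
    ∃ Q : Pred m n, IsS1 Q ∧ Equivalent Q fun _ _ V F G => ψ.Sat V F G := by
  induction h with
  | base h =>
    obtain ⟨Q, hQ, hQ'⟩ := (rep_not_of_isPi11 h).exists_isS1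
    exact ⟨Q, hQ, fun M _ _ V hV hT F G hF hG => by
      simpa only [not_not] using hQ' M V hV hT F G hF hG⟩
  | @ex m n φ _ ih =>
    obtain ⟨Q, hQ, hQ'⟩ := ih
    refine ⟨fun M _ V F G => ∃ Y, Sub Y V ∧ Q M V (Fin.snoc (α := fun _ => M) F Y) G,
      fun v F G => .ex (.and_left ?_), fun M _ _ V hV hT F G hF hG => ?_⟩
    · have h := hQ (v + 1) (Fin.snoc (α := fun _ => ℕ) (fun j => F j + 1) 0) (fun j => G j + 1)
      have he : ∀ (M : Type) (e : ℕ → M),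
          (fun j => e (Fin.snoc (α := fun _ => ℕ) (fun j => F j + 1) 0 j)) =
            Fin.snoc (α := fun _ => M) (fun j => e (F j + 1)) (e 0) := fun M e => by
        funext j
        refine Fin.lastCases ?_ (fun j => ?_) j <;> simp
      simp only [he] at h
      exact h
    · have hex : φ.ex₂.Sat V F G ↔
          ∃ Y, Sub Y V ∧ φ.Sat V (Fin.snoc (α := fun _ => M) F Y) G := by
        simp [ex₂, neg, Sat]
      refine Iff.trans (exists_congr fun Y => and_congr_right fun hY => ?_) hex.symm
      refine hQ' M V hV hT _ G (fun j => ?_) hG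
      exact Fin.lastCases (by simpa using hY) (fun j => by simpa using hF j) j

end SetThy

/-- For every `Σ¹₂`-formula `ψ` there is a `Σ₁`-formula `φ` such that ZFC entails the
translation sentence of `ψ` and `φ`. -/
theorem mainTheorem10 (k : ℕ) (ψ : SetThy.SOFml k 0) (hψ : ψ.IsSigma12) :
    ∃ φ : SetThy.Fml (k + 2), SetThy.IsSigma1 φ ∧
      FirstOrder.Language.Theory.ModelsBoundedFormula.{0, 0, 0} SetThy.ZFC
        (SetThy.translationSentence ψ φ) := by
  obtain ⟨Q, hQ, hQ'⟩ := SetThy.SOFml.exists_isS1_of_isSigma12 hψ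
  -- Entry 0 is `V` and entry `j + 1` is `A_j`. Later entries do not matter to the predicate and
  -- default to the variable of the sequence, so the truth of `φ` does not depend on the sequence.
  obtain ⟨φ, hφ, hφ'⟩ := (hQ 0 (fun j => j + 1) Fin.elim0).exists_fml (N := k + 2)
    (SetThy.cons (Fin.last k).castSucc fun j =>
      if h : j < k then (⟨j, h⟩ : Fin k).castSucc.castSucc else Fin.last _)
  refine ⟨φ, hφ, fun M v xs => ?_⟩
  have : SetThy.ZFCM M := ⟨M.is_model⟩
  unfold SetThy.translationSentence
  obtain rfl := Subsingleton.elim xs default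
  refine FirstOrder.Language.BoundedFormula.realize_alls.2 fun xs => ?_
  simp only [FirstOrder.Language.BoundedFormula.realize_imp,
    FirstOrder.Language.BoundedFormula.realize_iff,
    FirstOrder.Language.BoundedFormula.realize_inf,
    FirstOrder.Language.BoundedFormula.realize_iInf, SetThy.realize_ex,
    SetThy.realize_isStrongLimitSeq, SetThy.realize_isStage, SetThy.realize_isSubset,
    SetThy.SOFml.realize_satIn, Fin.snoc_castSucc, Fin.snoc_last, hφ']
  rintro ⟨l, hs, hl⟩ hA
  obtain ⟨hV, hT⟩ := SetThy.exists_tower hs hl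
  convert hQ' M (xs (Fin.last k).castSucc) hV hT (fun j => xs j.castSucc.castSucc)
    (fun j => xs (Fin.elim0 j)) hA (fun j => j.elim0) using 2
  · simp [SetThy.cons]
  · funext j
    simp [SetThy.cons]
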